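/- Let $n\ge 0$, $\Lambda\subseteq\mathbb Z^n$ be finite or infinite, and let $d(x,y)$ be the graph distance in the subgraph of the nearest-neighbour lattice $\mathbb Z^n$ induced on $\Lambda$ (sets meeting several connected components of $\Lambda$ have infinite diameter). Write $(\delta_x)_{x\in\Lambda}$ for the canonical basis of $\ell^2(\Lambda)$, and for a bounded operator $A$ let $\operatorname{supp}A$ be the set of $x$ such that $\langle\delta_y,A\delta_x\rangle\ne0$ or $\langle\delta_x,A\delta_y\rangle\neq 0$ for some $y$. An $(R,I,N)$-local Lindbladian on $\Lambda$ is $$\mathcal L(\rho)=-i[H,\rho]+\sum_{Z\subseteq\Lambda}\sum_{\alpha\in I_Z}\Big[L_\alpha\rho L_\alpha^*-\tfrac12\big(L_\alpha^*L_\alpha\rho+\rho L_\alpha^*L_\alpha\big)\Big],\qquad H=\sum_{Z\subseteq\Lambda}h_Z,$$ where $h_Z=h_Z^*$ and $L_\alpha$ ($\alpha\in I_Z$) are bounded operators on $\ell^2(\Lambda)$ supported in $Z$ that vanish if $\operatorname{diam}Z>R$, with $|I_Z|\le I$, $\|h_Z\|\le N$ and $\|L_\alpha\|\le N$. A state is a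 non-negative trace-class operator of trace $1$; a steady state is a state $\rho$ with $\mathcal L(\rho)=0$; for $\varepsilon>0$ the Abel average is $\mathcal A_\varepsilon(\rho)=\varepsilon\int_0^\infty e^{-t\varepsilon}e^{t\mathcal L}(\rho)\,dt$. For finite $\Omega\subseteq\Lambda$ let $$D_\Omega=-i\sum_{Z\subseteq\Omega}h_Z-\tfrac12\sum_{Z\subseteq\Omega}\sum_{\alpha\in I_Z}L_\alpha^*L_\alpha$$ as an operator on $\ell^2(\Omega)$. For $x,y\in\Lambda$ with $d(x,y)<\infty$ let $\Lambda_x=\{u\in\Lambda: d(x,u)\le d(x,y)/3\}$, $\Lambda_y=\{v\in\Lambda: d(y,v)\le d(x,y)/3\}$, and for $u\in\Lambda_x$, $v\in\Lambda_y$ $$k^\varepsilon_{x,y}(u,v)=\int_{\Gamma_\varepsilon}\langle\delta_x,(z-D_{\Lambda_x})^{-1}\delta_u\rangle\,\langle\delta_v,(\varepsilon-z-D_{\Lambda_y}^*)^{-1}\delta_y\rangle\,\frac{dz}{2\pi i},$$ where $\Gamma_\varepsilon$ is any closed piecewise $C^1$ contour in $\{\operatorname{Re}z<\varepsilon\}\setminus\sigma(D_{\Lambda_x})$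 winding once anticlockwise around every point of $\sigma(D_{\Lambda_x})$. **Theorem.** Given $n,R,I,N$ and $\gamma>0$ there are constants $C,\mu\in(0,\infty)$ such that for every $\Lambda\subseteq\mathbb Z^n$ and every $(R,I,N)$-local Lindbladian on $\Lambda$ satisfying the uniform gap condition $$\tfrac12\sum_{Z\subseteq\Omega}\sum_{\alpha\in I_Z}L_\alpha^*L_\alpha\ \ge\ \gamma\,1_\Omega\qquad\text{for every finite }\Omega\subseteq\Lambda$$ the following hold. 1. For all $\varepsilon>0$, all $x,y\in\Lambda$ with $d(x,y)<\infty$, every contour $\Gamma_\varepsilon$ as above and all $u\in\Lambda_x$, $v\in\Lambda_y$: $\ |k^\varepsilon_{x,y}(u,v)|\le C e^{-\mu d(x,u)}e^{-\mu d(y,v)}$. 2. For every state $\rho$ and every $\varepsilon>0$ the integral defining $\mathcal A_\varepsilon(\rho)$ converges absolutely in operator norm, and for all $x\ne y$ in $\Lambda$ with $d(x,y)<\infty$ $$|\langle\delta_x,\mathcal A_\varepsilon(\rho)\delta_y\rangle|\le C\,d(x,y)^{3(n-1)}e^{-\mu d(x,y)/3}+\varepsilon\,C\sum_{u\in\Lambda_x}\sum_{v\in\Lambda_y}e^{-\mu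 d(x,u)}e^{-\mu d(y,v)}\,|\langle\delta_u,\rho\,\delta_v\rangle|.$$ 3. Every steady state $\rho_\infty$ satisfies $|\langle\delta_x,\rho_\infty\delta_y\rangle|\le C\,d(x,y)^{3(n-1)}e^{-\mu d(x,y)/3}$ for all $x\neq y$ in $\Lambda$ with $d(x,y)<\infty$. Moreover, any amount of local dephasing yields the gap condition: if $c\in\mathbb C\setminus\{0\}$ and for every $v\in\Lambda$ the operator $c\,|\delta_v\rangle\langle\delta_v|$ is among the $L_\alpha$, $\alpha\in I_{\{v\}}$, then the gap condition holds with $\gamma=|c|^2/2$. (Here, if $n=0$, the exponent $3(n-1)$ is read as $0$; parts 2 and 3 are then void.) -/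

import Mathlib

open scoped Matrix InnerProductSpace

noncomputable section

namespace LindbladLattice

/-! ### The lattice and subsets of it -/

/-- The lattice `ℤⁿ` as a graph: two points are neighbours when their `ℓ¹`-distance is `1`. -/
def latticeGraph (n : ℕ) : SimpleGraph (Fin n → ℤ) where
  Adj x y := ∑ i, |x i - y i| = 1
  symm := ⟨fun x y h => by simpa only [abs_sub_comm] using h⟩
  loopless := ⟨fun x h => by simp at h⟩

variable {n : ℕ} {Λ : Set (Fin n → ℤ)}

/-- The graph induced by `ℤⁿ` on `Λ`; distances are measured inside this graph. -/
abbrev graphOn (Λ : Set (Fin n → ℤ)) : SimpleGraph Λ := (latticeGraph n).induce Λ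

/-- `x` and `y` have finite graph distance in `Λ`. -/
def FiniteDist (x y : Λ) : Prop := (graphOn Λ).Reachable x y

/-- The graph distance in `Λ` (meaningful for points satisfying `FiniteDist`). -/
def gdist (x y : Λ) : ℝ := (graphOn Λ).dist x y

/-- The set `Z` has diameter at most `R` in the graph `Λ`; in particular its points have
finite distances from each other. -/
def DiamLE (Z : Finset Λ) (R : ℝ) : Prop :=
  ∀ x ∈ Z, ∀ y ∈ Z, FiniteDist x y ∧ gdist x y ≤ R

theorem abs_sub_le_walk_length {x y : Λ} (p : (graphOn Λ).Walk x y) (i : Fin n) :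
    |x.1 i - y.1 i| ≤ (p.length : ℤ) := by
  induction p with
  | nil => simp
  | @cons a b c hab p ih =>
    have h1 : |a.1 i - b.1 i| ≤ 1 := by
      have hs : ∑ j, |a.1 j - b.1 j| = 1 := hab
      rw [← hs]
      exact Finset.single_le_sum (f := fun j => |a.1 j - b.1 j|)
        (fun j _ => abs_nonneg _) (Finset.mem_univ i)
    have h2 := abs_sub_le (a.1 i) (b.1 i) (c.1 i)
    rw [SimpleGraph.Walk.length_cons]
    push_cast
    linarith

/-- Balls of the graph `Λ` are finite. -/
theorem finite_ball (x : Λ) (r : ℝ) : {u : Λ | FiniteDist x u ∧ gdist x u ≤ r}.Finite := by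
  have hfin : (Set.Icc (fun i => x.1 i - ⌈r⌉) (fun i => x.1 i + ⌈r⌉)).Finite := Set.finite_Icc _ _
  refine Set.Finite.subset (hfin.preimage (f := (Subtype.val : Λ → Fin n → ℤ))
    Subtype.val_injective.injOn) ?_
  rintro u ⟨hu, hr⟩
  obtain ⟨p, hp⟩ := hu.exists_walk_length_eq_dist
  have hle : (p.length : ℤ) ≤ ⌈r⌉ := by
    have h1 : ((p.length : ℤ) : ℝ) ≤ r := by
      rw [hp]
      exact_mod_cast hr
    exact_mod_cast h1.trans (Int.le_ceil r)
  have h := fun i => abs_le.1 ((abs_sub_le_walk_length p i).trans hle)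
  exact ⟨fun i => by have := (h i).2; simp only; linarith,
    fun i => by have := (h i).1; simp only; linarith⟩

/-- The ball of radius `r` around `x` in the graph `Λ`, as a finite set. -/
def ball (x : Λ) (r : ℝ) : Finset Λ := (finite_ball x r).toFinset

/-- For two points `x`, `y`, the ball `Λ_x` of radius `d(x,y)/3` around `x`. The ball `Λ_y` is
`third y x`. -/
def third (x y : Λ) : Finset Λ := ball x (gdist x y / 3)

theorem self_mem_third (x y : Λ) : x ∈ third x y := by
  have h : (0 : ℝ) ≤ gdist x y / 3 := div_nonneg (Nat.cast_nonneg _) (by norm_num)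
  rw [third, ball, Set.Finite.mem_toFinset]
  exact ⟨SimpleGraph.Reachable.refl x, by simpa [gdist] using h⟩

/-! ### Operators on `ℓ²(Λ)` -/

/-- The Hilbert space `ℓ²(Λ)`. -/
abbrev Ell2 (Λ : Set (Fin n → ℤ)) : Type := lp (fun _ : Λ => ℂ) 2

/-- The bounded operators on `ℓ²(Λ)`. -/
abbrev Op (Λ : Set (Fin n → ℤ)) : Type := Ell2 Λ →L[ℂ] Ell2 Λ

/-- The canonical position basis. -/
def δ (x : Λ) : Ell2 Λ := lp.single 2 x 1

/-- The matrix element `⟨δ_x, A δ_y⟩`. -/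
def elt (A : Op Λ) (x y : Λ) : ℂ := ⟪δ x, A (δ y)⟫_ℂ

/-- The support of an operator. -/
def opSupport (A : Op Λ) : Set Λ := {x | ∃ y, elt A y x ≠ 0 ∨ elt A x y ≠ 0}

/-- The projection `1_Ω` for a finite `Ω`. -/
def proj (Ω : Finset Λ) : Op Λ := ∑ v ∈ Ω, InnerProductSpace.rankOne ℂ (δ v) (δ v)

open Classical in
/-- The (unique) bounded operator to which a series of operators converges unconditionally in the
strong operator topology (and `0` if there is none). For finite index types this is the sum. -/
def strongSum {ι : Type} (f : ι → Op Λ) : Op Λ :=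
  if h : ∃ T : Op Λ, ∀ ψ, HasSum (fun i => f i ψ) (T ψ) then h.choose else 0

/-- Quantum states: non-negative trace-class operators of trace `1`. A non-negative operator is
trace class with trace `τ` exactly if its diagonal in an orthonormal basis sums up to `τ`. -/
structure IsState (ρ : Op Λ) : Prop where
  nonneg : ρ.IsPositive
  trace_eq_one : HasSum (fun x => elt ρ x x) 1

/-! ### Local Lindbladians -/

/-- The terms of a Lindbladian on `Λ`: for every finite `Z ⊆ Λ` a Hamiltonian term `h_Z` and a
finite family of Lindblad operators, here indexed by `Fin (numJump Z)`. (Infinite sets `Z` have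
infinite diameter and carry no terms.) -/
structure LindbladTerms (Λ : Set (Fin n → ℤ)) where
  ham : Finset Λ → Op Λ
  numJump : Finset Λ → ℕ
  jump : (Z : Finset Λ) → Fin (numJump Z) → Op Λ

namespace LindbladTerms

/-- `(R, I, N)`-locality. -/
structure IsLocal (T : LindbladTerms Λ) (R : ℝ) (I : ℕ) (N : ℝ) : Prop where
  ham_selfAdjoint : ∀ Z, IsSelfAdjoint (T.ham Z)
  ham_support : ∀ Z, opSupport (T.ham Z) ⊆ Z
  jump_support : ∀ Z i, opSupport (T.jump Z i) ⊆ Z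
  ham_eq_zero : ∀ Z, ¬ DiamLE Z R → T.ham Z = 0
  jump_eq_zero : ∀ Z, ¬ DiamLE Z R → ∀ i, T.jump Z i = 0
  numJump_le : ∀ Z, T.numJump Z ≤ I
  norm_ham_le : ∀ Z, ‖T.ham Z‖ ≤ N
  norm_jump_le : ∀ Z i, ‖T.jump Z i‖ ≤ N

/-- `∑_{α ∈ I_Z} L_α^* L_α`. -/
def jumpSq (T : LindbladTerms Λ) (Z : Finset Λ) : Op Λ :=
  ∑ i, (T.jump Z i).adjoint * T.jump Z i

/-- The Hamiltonian `H = ∑_Z h_Z`. -/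
def hamiltonian (T : LindbladTerms Λ) : Op Λ := strongSum T.ham

/-- The local dissipator
`𝓓_Z(ρ) = ∑_{α ∈ I_Z} (L_α ρ L_α^* - (L_α^* L_α ρ + ρ L_α^* L_α) / 2)`. -/
def dissipator (T : LindbladTerms Λ) (Z : Finset Λ) (ρ : Op Λ) : Op Λ :=
  ∑ i, (T.jump Z i * ρ * (T.jump Z i).adjoint
    - (1 / 2 : ℂ) • ((T.jump Z i).adjoint * T.jump Z i * ρ
      + ρ * ((T.jump Z i).adjoint * T.jump Z i)))

/-- The Lindbladian `𝓛(ρ) = -i [H, ρ] + ∑_Z 𝓓_Z(ρ)`. For local terms all series converge, and `𝓛`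
is bounded on trace-class operators and, by the same formula, on all bounded operators. -/
def lindbladian (T : LindbladTerms Λ) (ρ : Op Λ) : Op Λ :=
  (-Complex.I) • (T.hamiltonian * ρ - ρ * T.hamiltonian) + strongSum (fun Z => T.dissipator Z ρ)

/-- The time evolution `e^{t𝓛}(ρ) = ∑_k t^k / k! 𝓛^k(ρ)`. As `𝓛` is bounded, for a trace-class `ρ`
the series converges in trace norm, hence in operator norm, to the same limit. -/
def evolution (T : LindbladTerms Λ) (t : ℝ) (ρ : Op Λ) : Op Λ :=
  ∑' k : ℕ, ((t ^ k / (k.factorial : ℝ) : ℝ) : ℂ) • T.lindbladian^[k] ρ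

/-- The integrand `e^{-tε} e^{t𝓛}(ρ)` of the Abel average. -/
def abelIntegrand (T : LindbladTerms Λ) (ε : ℝ) (ρ : Op Λ) (t : ℝ) : Op Λ :=
  ((Real.exp (-(t * ε)) : ℝ) : ℂ) • T.evolution t ρ

/-- The Abel average `𝓐_ε(ρ) = ε ∫_0^∞ e^{-tε} e^{t𝓛}(ρ) dt`. -/
def abelAverage (T : LindbladTerms Λ) (ε : ℝ) (ρ : Op Λ) : Op Λ :=
  (ε : ℂ) • ∫ t in Set.Ioi (0 : ℝ), T.abelIntegrand ε ρ t

/-- Uniform gap: `(1/2) ∑_{Z ⊆ Ω} ∑_{α ∈ I_Z} L_α^* L_α ≥ γ 1_Ω` for every finite `Ω ⊆ Λ`. -/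
def HasUniformGap (T : LindbladTerms Λ) (γ : ℝ) : Prop :=
  ∀ Ω : Finset Λ, (γ : ℂ) • proj Ω ≤ (1 / 2 : ℂ) • ∑ Z ∈ Ω.powerset, T.jumpSq Z

/-- The generator of the non-hermitian evolution in a finite set `Ω`,
`D_Ω = -i ∑_{Z ⊆ Ω} h_Z - (1/2) ∑_{Z ⊆ Ω} ∑_{α ∈ I_Z} L_α^* L_α`, an operator on `ℓ²(Ω) = ℂ^Ω`,
as a matrix. -/
def nonHermitian (T : LindbladTerms Λ) (Ω : Finset Λ) : Matrix Ω Ω ℂ :=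
  Matrix.of fun u v => elt ((-Complex.I) • ∑ Z ∈ Ω.powerset, T.ham Z
    - (1 / 2 : ℂ) • ∑ Z ∈ Ω.powerset, T.jumpSq Z) u v

end LindbladTerms

/-! ### Contours and the kernel -/

/-- A contour: a closed, piecewise continuously differentiable curve in `ℂ`, parametrised by
`[0, 1]`. -/
structure IsContour (Γ : ℝ → ℂ) : Prop where
  closed : Γ 0 = Γ 1
  piecewise : ∃ (m : ℕ) (t : ℕ → ℝ), Monotone t ∧ t 0 = 0 ∧ t m = 1 ∧
    ∀ i < m, ContDiffOn ℝ 1 Γ (Set.Icc (t i) (t (i + 1)))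

/-- The normalised contour integral `∮_Γ f(z) dz / (2πi)`. -/
def contourIntegral (Γ : ℝ → ℂ) (f : ℂ → ℂ) : ℂ :=
  (2 * Real.pi * Complex.I)⁻¹ * ∫ t in (0 : ℝ)..1, f (Γ t) * deriv Γ t

/-- `Γ` avoids the set `K` and winds once anticlockwise around each of its points. -/
def WindsOnceAround (Γ : ℝ → ℂ) (K : Set ℂ) : Prop :=
  ∀ w ∈ K, (∀ t ∈ Set.Icc (0 : ℝ) 1, Γ t ≠ w) ∧ contourIntegral Γ (fun z => (z - w)⁻¹) = 1

/-- The contours admitted in the definition of the kernel: they lie in the half plane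
`Re z < ε` and wind once anticlockwise around the spectrum of `D_{Λ_x}`. -/
structure IsAdmissibleContour (T : LindbladTerms Λ) (x y : Λ) (ε : ℝ) (Γ : ℝ → ℂ) : Prop where
  isContour : IsContour Γ
  re_lt : ∀ t ∈ Set.Icc (0 : ℝ) 1, (Γ t).re < ε
  winds : WindsOnceAround Γ (spectrum ℂ (T.nonHermitian (third x y)))

/-- The kernel (without boundary Lindbladian) associated to `x`, `y`, computed with the contour
`Γ`:
`k(u,v) = ∮_Γ ⟨δ_x, (z - D_{Λ_x})⁻¹ δ_u⟩ ⟨δ_v, (ε - z - D_{Λ_y}^*)⁻¹ δ_y⟩ dz / (2πi)`. -/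
def kernel (T : LindbladTerms Λ) (x y : Λ) (ε : ℝ) (Γ : ℝ → ℂ)
    (u : third x y) (v : third y x) : ℂ :=
  contourIntegral Γ fun z =>
    (z • (1 : Matrix (third x y) (third x y) ℂ) - T.nonHermitian (third x y))⁻¹
        ⟨x, self_mem_third x y⟩ u
      * (((ε : ℂ) - z) • (1 : Matrix (third y x) (third y x) ℂ)
          - (T.nonHermitian (third y x))ᴴ)⁻¹ v ⟨y, self_mem_third y x⟩

end LindbladLattice

end

open LindbladLattice

noncomputable section

namespace LindbladLattice

variable {n : ℕ} {Λ : Set (Fin n → ℤ)}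

/-! ### Contour integrals -/

section Contour

open MeasureTheory Set

variable {Γ : ℝ → ℂ}

/-! Let `X` have norm at most `1` and satisfy `εX - 𝓛(X) = ερ`. This covers the Abel average of a
state `ρ` and, with `ε = 0` and zero source, a steady state. Consider the block of matrix elements
of `X` over `Λ_x × Λ_y`. If `d(x,y) > 3R`, points of the two balls are more than `R` apart, so the
terms `L X L^*` drop out. The block then solves the Sylvester equation `εX - D_{Λ_x} X - X D_{Λ_y}^*
= ερ + boundary terms`, whose boundary terms live within `R` of the edge of one of the balls
(`norm_sylvester_block_le`).

The gap says that `D_Ω` is dissipative with rate `γ`. As `D_Ω` has range `R` and uniformly bounded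
entries, conjugation with weights `exp(ν d(x,·))`, `ν` small, costs at most `γ/2`
(`isDissipative_exp`, a Combes-Thomas argument). Pairing the Sylvester equation with its weighted
solution gives an `ℓ²` bound (`IsDissipative.sylvester_le`), hence exponential decay of its Green
function. Summing the Green function against the source and the boundary terms gives the decay of
`X`; for `d(x,y) ≤ 3R` the bound `‖X‖ ≤ 1` suffices. The polynomial prefactor is at least `1` and
only weakens the estimate.

The kernel is this Green function: the contour integral solves the Sylvester equation with a matrix
unit as source (`sylvester_contourIntegral_eq_single`), because one resolvent integrates to the
identity and the other to zero.

The bound `‖X‖ ≤ 1` for Abel averages requires `‖e^{t𝓛}ρ‖ ≤ 1`. Euler steps, corrected at second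
order to be completely positive, map mixtures `∑ |φᵢ⟩⟨φᵢ|` to mixtures and increase `∑ ‖φᵢ‖²` only
by a factor `1 + O(s²)`; their powers converge to `e^{t𝓛}` (`norm_evolution_le`). -/

theorem exists_mem_Icc_of_partition {t : ℕ → ℝ} (m : ℕ) {s : ℝ} (hs : s ∈ Ioc (t 0) (t m)) :
    ∃ i < m, s ∈ Ioc (t i) (t (i + 1)) := by
  induction m with
  | zero => simp at hs
  | succ k ih =>
    rcases le_or_gt s (t k) with h | h
    · obtain ⟨i, hi, hi'⟩ := ih ⟨hs.1, h⟩
      exact ⟨i, hi.trans (Nat.lt_succ_self k), hi'⟩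
    · exact ⟨k, Nat.lt_succ_self k, h, hs.2⟩

theorem IsContour.continuousOn (h : IsContour Γ) : ContinuousOn Γ (Icc 0 1) := by
  obtain ⟨m, t, ht, h0, h1, hd⟩ := h.piecewise
  have key : ∀ k ≤ m, ContinuousOn Γ (Icc (t 0) (t k)) := by
    intro k
    induction k with
    | zero => intro _; simp
    | succ k ih =>
      intro hk
      have := (ih (by omega)).union_of_isClosed (hd k (by omega)).continuousOn isClosed_Icc
        isClosed_Icc
      rwa [Icc_union_Icc_eq_Icc (ht (Nat.zero_le k)) (ht (Nat.le_succ k))] at this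
  simpa [h0, h1] using key m le_rfl

theorem IsContour.exists_countable_hasDerivAt (h : IsContour Γ) :
    ∃ s : Set ℝ, s.Countable ∧ ∀ r ∈ Ioo (0 : ℝ) 1 \ s, HasDerivAt Γ (deriv Γ r) r := by
  obtain ⟨m, t, ht, h0, h1, hd⟩ := h.piecewise
  refine ⟨range t, countable_range t, ?_⟩
  rintro r ⟨hr, hrt⟩
  obtain ⟨i, hi, hr1, hr2⟩ := exists_mem_Icc_of_partition (t := t) m (s := r)
    (by rw [h0, h1]; exact ⟨hr.1, hr.2.le⟩)
  have hlt : r < t (i + 1) := lt_of_le_of_ne hr2 fun e => hrt ⟨_, e.symm⟩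
  exact (((hd i hi).differentiableOn one_ne_zero).differentiableAt
    (Icc_mem_nhds hr1 hlt)).hasDerivAt

/-- At a break point `deriv Γ` may be the default value `0`. In the interior of each piece it equals
`derivWithin`, which is continuous up to the ends of the piece, and the interval integral ignores
the end points. -/
theorem IsContour.intervalIntegrable (h : IsContour Γ) {f : ℂ → ℂ}
    (hf : ContinuousOn (fun t => f (Γ t)) (Icc 0 1)) :
    IntervalIntegrable (fun t => f (Γ t) * deriv Γ t) volume 0 1 := by
  obtain ⟨m, t, ht, h0, h1, hd⟩ := h.piecewise
  have key : ∀ k < m, IntervalIntegrable (fun t => f (Γ t) * deriv Γ t) volume (t k)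
      (t (k + 1)) := by
    intro k hk
    rcases (ht (Nat.le_succ k)).eq_or_lt with he | hlt
    · rw [← he]
    have hsub : Icc (t k) (t (k + 1)) ⊆ Icc 0 1 := by
      rw [← h0, ← h1]
      exact Icc_subset_Icc (ht (Nat.zero_le k)) (ht hk)
    have hc : ContinuousOn (fun s => f (Γ s) * derivWithin Γ (Icc (t k) (t (k + 1))) s)
        (Icc (t k) (t (k + 1))) :=
      (hf.mono hsub).mul ((hd k hk).continuousOn_derivWithin (uniqueDiffOn_Icc hlt) le_rfl)
    refine (hc.intervalIntegrable_of_Icc hlt.le).congr_uIoo ?_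
    intro s hs
    rw [uIoo_of_le hlt.le] at hs
    simp only
    rw [derivWithin_of_mem_nhds (Icc_mem_nhds hs.1 hs.2)]
  simpa [h0, h1] using IntervalIntegrable.trans_iterate key

/-- A primitive along the closed curve suffices; the fundamental theorem of calculus tolerates the
countably many break points. -/
theorem contourIntegral_eq_zero (h : IsContour Γ) {F f : ℂ → ℂ}
    (hF : ∀ t ∈ Icc (0 : ℝ) 1, HasDerivAt F (f (Γ t)) (Γ t))
    (hf : ContinuousOn (fun t => f (Γ t)) (Icc 0 1)) : contourIntegral Γ f = 0 := by
  obtain ⟨s, hs, hd⟩ := h.exists_countable_hasDerivAt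
  have := integral_eq_of_hasDerivAt_off_countable_of_le (fun t => F (Γ t))
    (fun t => f (Γ t) * deriv Γ t) zero_le_one hs ?_ ?_ (h.intervalIntegrable hf)
  · rw [contourIntegral, this, h.closed, sub_self, mul_zero]
  · intro t ht
    exact (hF t ht).continuousAt.comp_continuousWithinAt (h.continuousOn t ht)
  · intro t ht
    exact (hF t ⟨ht.1.1.le, ht.1.2.le⟩).comp t (hd t ht)

theorem contourIntegral_congr {f g : ℂ → ℂ} (hfg : ∀ t ∈ Icc (0 : ℝ) 1, f (Γ t) = g (Γ t)) :
    contourIntegral Γ f = contourIntegral Γ g := by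
  unfold contourIntegral
  congr 1
  refine intervalIntegral.integral_congr fun t ht => ?_
  rw [uIcc_of_le zero_le_one] at ht
  simp only [hfg t ht]

theorem contourIntegral_sum (h : IsContour Γ) {ι : Type*} (s : Finset ι) {f : ι → ℂ → ℂ}
    (hf : ∀ i ∈ s, ContinuousOn (fun t => f i (Γ t)) (Icc 0 1)) :
    contourIntegral Γ (fun z => ∑ i ∈ s, f i z) = ∑ i ∈ s, contourIntegral Γ (f i) := by
  unfold contourIntegral
  rw [← Finset.mul_sum, ← intervalIntegral.integral_finsetSum]
  · simp only [Finset.sum_mul]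
  · exact fun i hi => h.intervalIntegrable (hf i hi)

theorem contourIntegral_add (h : IsContour Γ) {f g : ℂ → ℂ}
    (hf : ContinuousOn (fun t => f (Γ t)) (Icc 0 1))
    (hg : ContinuousOn (fun t => g (Γ t)) (Icc 0 1)) :
    contourIntegral Γ (fun z => f z + g z) = contourIntegral Γ f + contourIntegral Γ g := by
  unfold contourIntegral
  rw [← mul_add, ← intervalIntegral.integral_add (h.intervalIntegrable hf)
    (h.intervalIntegrable hg)]
  simp only [add_mul]

theorem contourIntegral_const_mul (c : ℂ) (f : ℂ → ℂ) :
    contourIntegral Γ (fun z => c * f z) = c * contourIntegral Γ f := by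
  unfold contourIntegral
  simp only [mul_assoc, intervalIntegral.integral_const_mul]
  ring

theorem contourIntegral_mul_const (c : ℂ) (f : ℂ → ℂ) :
    contourIntegral Γ (fun z => f z * c) = contourIntegral Γ f * c := by
  simp only [mul_comm _ c, contourIntegral_const_mul]

theorem contourIntegral_neg (f : ℂ → ℂ) :
    contourIntegral Γ (fun z => -f z) = -contourIntegral Γ f := by
  simpa using contourIntegral_const_mul (Γ := Γ) (-1) f

theorem IsContour.continuousOn_inv_pow (h : IsContour Γ) {w : ℂ}
    (hw : ∀ t ∈ Icc (0 : ℝ) 1, Γ t ≠ w) (k : ℕ) :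
    ContinuousOn (fun t => ((Γ t - w) ^ k)⁻¹) (Icc 0 1) :=
  ((h.continuousOn.sub continuousOn_const).pow k).inv₀
    fun t ht => pow_ne_zero _ (sub_ne_zero.2 (hw t ht))

/-- Poles of order at least two have a primitive, so only the simple pole of a Laurent polynomial
contributes to its integral. -/
theorem contourIntegral_inv_pow (h : IsContour Γ) {w : ℂ}
    (hw : ∀ t ∈ Icc (0 : ℝ) 1, Γ t ≠ w) (k : ℕ) :
    contourIntegral Γ (fun z => ((z - w) ^ (k + 2))⁻¹) = 0 := by
  refine contourIntegral_eq_zero h (F := fun z => -((k + 1 : ℂ))⁻¹ * ((z - w) ^ (k + 1))⁻¹) ?_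
    (h.continuousOn_inv_pow hw (k + 2))
  intro t ht
  have h0 : Γ t - w ≠ 0 := sub_ne_zero.2 (hw t ht)
  have h1 : (k + 1 : ℂ) ≠ 0 := by exact_mod_cast Nat.succ_ne_zero k
  have := ((((hasDerivAt_id (Γ t)).sub_const w).pow (k + 1)).inv
    (by simpa using pow_ne_zero (k + 1) h0)).const_mul (-((k + 1 : ℂ))⁻¹)
  refine HasDerivAt.congr_deriv this ?_
  simp only [id, Pi.pow_apply, Nat.add_sub_cancel]
  push_cast
  field_simp
  ring

/-- `w - Γ` stays in the right half plane, where the principal logarithm is a primitive; no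
deformation of the contour is needed. -/
theorem contourIntegral_inv_eq_zero (h : IsContour Γ) {w : ℂ}
    (hw : ∀ t ∈ Icc (0 : ℝ) 1, (Γ t).re < w.re) :
    contourIntegral Γ (fun z => (z - w)⁻¹) = 0 := by
  have hne : ∀ t ∈ Icc (0 : ℝ) 1, Γ t ≠ w := fun t ht e => by simpa [e] using hw t ht
  refine contourIntegral_eq_zero h (F := fun z => Complex.log (w - z)) ?_
    (by simpa using h.continuousOn_inv_pow hne 1)
  intro t ht
  have h1 : w - Γ t ∈ Complex.slitPlane := Or.inl (by simpa using hw t ht)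
  have := ((hasDerivAt_id (Γ t)).const_sub w).clog h1
  refine HasDerivAt.congr_deriv this ?_
  rw [id, ← neg_sub w, inv_neg, neg_div, one_div]

end Contour

/-! ### Contour integrals of resolvents -/

section Resolvent

open Set

variable {Γ : ℝ → ℂ} {ι : Type*} [Fintype ι] [DecidableEq ι]

theorem isUnit_det_smul_one_sub {A : Matrix ι ι ℂ} {z : ℂ} (hz : z ∉ spectrum ℂ A) :
    IsUnit (z • (1 : Matrix ι ι ℂ) - A).det := by
  rw [← Matrix.isUnit_iff_isUnit_det]
  simpa [spectrum.mem_iff, Algebra.algebraMap_eq_smul_one] using hz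

theorem IsContour.continuousOn_resolvent (h : IsContour Γ) {A : Matrix ι ι ℂ}
    (hA : ∀ t ∈ Icc (0 : ℝ) 1, Γ t ∉ spectrum ℂ A) (i j : ι) :
    ContinuousOn (fun t => (Γ t • (1 : Matrix ι ι ℂ) - A)⁻¹ i j) (Icc 0 1) := by
  simp only [Matrix.inv_def, Matrix.smul_apply, Ring.inverse_eq_inv', smul_eq_mul]
  have hB : Continuous fun z : ℂ => z • (1 : Matrix ι ι ℂ) - A := by fun_prop
  have h1 : ContinuousOn (fun t => (Γ t • (1 : Matrix ι ι ℂ) - A).det) (Icc 0 1) :=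
    hB.matrix_det.comp_continuousOn h.continuousOn
  have h2 : ContinuousOn (fun t => (Γ t • (1 : Matrix ι ι ℂ) - A).adjugate i j) (Icc 0 1) :=
    (hB.matrix_adjugate.matrix_elem i j).comp_continuousOn h.continuousOn
  exact (h1.inv₀ fun t ht => (isUnit_det_smul_one_sub (hA t ht)).ne_zero).mul h2

/-- On a generalised eigenvector `A - w` is nilpotent, so the Neumann series for the resolvent
terminates; applying `z - A` to it telescopes. -/
theorem resolvent_mulVec_of_pow_eq_zero {A : Matrix ι ι ℂ} {z w : ℂ} (hz : z ∉ spectrum ℂ A)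
    (hzw : z ≠ w) {v : ι → ℂ} {k : ℕ} (hv : (A - w • (1 : Matrix ι ι ℂ)) ^ k *ᵥ v = 0) :
    (z • (1 : Matrix ι ι ℂ) - A)⁻¹ *ᵥ v
      = ∑ j ∈ Finset.range k,
          ((z - w) ^ (j + 1))⁻¹ • ((A - w • (1 : Matrix ι ι ℂ)) ^ j *ᵥ v) := by
  set B := A - w • (1 : Matrix ι ι ℂ) with hB
  have h0 : z - w ≠ 0 := sub_ne_zero.2 hzw
  have hu := isUnit_det_smul_one_sub hz
  have hzA : z • (1 : Matrix ι ι ℂ) - A = (z - w) • 1 - B := by rw [hB, sub_smul]; abel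
  have key : (z • (1 : Matrix ι ι ℂ) - A) *ᵥ (∑ j ∈ Finset.range k,
      ((z - w) ^ (j + 1))⁻¹ • (B ^ j *ᵥ v)) = v := by
    rw [hzA, Matrix.mulVec_sum]
    have : ∀ j ∈ Finset.range k, ((z - w) • (1 : Matrix ι ι ℂ) - B) *ᵥ
        (((z - w) ^ (j + 1))⁻¹ • (B ^ j *ᵥ v))
        = ((z - w) ^ j)⁻¹ • (B ^ j *ᵥ v) - ((z - w) ^ (j + 1))⁻¹ • (B ^ (j + 1) *ᵥ v) := by
      intro j _
      rw [Matrix.sub_mulVec, Matrix.smul_mulVec, Matrix.one_mulVec, Matrix.mulVec_smul,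
        Matrix.mulVec_mulVec, ← pow_succ', smul_smul]
      congr 2
      rw [pow_succ]
      field_simp
    rw [Finset.sum_congr rfl this, Finset.sum_range_sub', hv]
    simp
  rw [← key, Matrix.mulVec_mulVec, key, Matrix.nonsing_inv_mul _ hu, Matrix.one_mulVec]

/-- Generalised eigenvectors span, and on each the resolvent is a polynomial in `(z - w)⁻¹` whose
simple pole alone survives integration. It is used with `c = 1` for an enclosed spectrum and `c = 0`
for a spectrum outside. -/
theorem contourIntegral_resolvent (h : IsContour Γ) {A : Matrix ι ι ℂ} {c : ℂ}
    (hA : ∀ w ∈ spectrum ℂ A, (∀ t ∈ Icc (0 : ℝ) 1, Γ t ≠ w) ∧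
      contourIntegral Γ (fun z => (z - w)⁻¹) = c) (i j : ι) :
    contourIntegral Γ (fun z => (z • (1 : Matrix ι ι ℂ) - A)⁻¹ i j) = if i = j then c else 0 := by
  have hA' : ∀ t ∈ Icc (0 : ℝ) 1, Γ t ∉ spectrum ℂ A := fun t ht hm => (hA _ hm).1 t ht rfl
  set P : Matrix ι ι ℂ := Matrix.of fun i j =>
    contourIntegral Γ (fun z => (z • (1 : Matrix ι ι ℂ) - A)⁻¹ i j) with hP
  have hPv : ∀ v i, (P *ᵥ v) i
      = contourIntegral Γ (fun z => ((z • (1 : Matrix ι ι ℂ) - A)⁻¹ *ᵥ v) i) := by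
    intro v i
    simp only [Matrix.mulVec, dotProduct]
    rw [contourIntegral_sum h]
    · simp [P, contourIntegral_mul_const]
    · exact fun k _ => (h.continuousOn_resolvent hA' i k).mul continuousOn_const
  have hle : ∀ w, Module.End.maxGenEigenspace (Matrix.toLin' A) w
      ≤ LinearMap.ker (Matrix.toLin' (P - c • (1 : Matrix ι ι ℂ))) := by
    intro w v hv
    obtain ⟨k, hk⟩ := Module.End.mem_maxGenEigenspace _ _ _ |>.1 hv
    rw [LinearMap.mem_ker, Matrix.toLin'_apply, Matrix.sub_mulVec, Matrix.smul_mulVec,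
      Matrix.one_mulVec, sub_eq_zero]
    by_cases hv0 : v = 0
    · simp [hv0]
    -- Off the spectrum `(A - w)^k` is invertible and cannot annihilate `v ≠ 0`.
    have hw : w ∈ spectrum ℂ A := by
      by_contra hw
      have hu : IsUnit ((A - w • (1 : Matrix ι ι ℂ)) ^ k) := by
        refine IsUnit.pow k ?_
        have := (Matrix.isUnit_iff_isUnit_det _).2 (isUnit_det_smul_one_sub hw)
        simpa using this.neg
      apply hv0
      have h3 : ((A - w • (1 : Matrix ι ι ℂ)) ^ k) *ᵥ v = 0 := by
        rw [← Matrix.toLin'_apply, Matrix.toLin'_pow, map_sub, map_smul, Matrix.toLin'_one]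
        exact hk
      have := congrArg (fun u => ((A - w • (1 : Matrix ι ι ℂ)) ^ k)⁻¹ *ᵥ u) h3
      simpa [Matrix.mulVec_mulVec,
        Matrix.nonsing_inv_mul _ ((Matrix.isUnit_iff_isUnit_det _).1 hu)] using this
    obtain ⟨hne, hc⟩ := hA w hw
    -- The exponent `k + 1` guarantees that the sum contains the simple-pole term `j = 0`, which is
    -- split off below.
    have h3 : ((A - w • (1 : Matrix ι ι ℂ)) ^ (k + 1)) *ᵥ v = 0 := by
      rw [← Matrix.toLin'_apply, Matrix.toLin'_pow, map_sub, map_smul, Matrix.toLin'_one, pow_succ',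
        Module.End.mul_apply]
      exact (congrArg _ hk).trans (map_zero _)
    ext i
    rw [hPv, contourIntegral_congr (g := fun z => ∑ j ∈ Finset.range (k + 1),
      ((z - w) ^ (j + 1))⁻¹ * ((A - w • (1 : Matrix ι ι ℂ)) ^ j *ᵥ v) i)]
    · rw [contourIntegral_sum h _ fun j _ =>
        (h.continuousOn_inv_pow hne (j + 1)).mul continuousOn_const, Finset.sum_range_succ']
      simp only [contourIntegral_mul_const, contourIntegral_inv_pow h hne]
      simp [hc]
    · intro t ht
      rw [resolvent_mulVec_of_pow_eq_zero (hA' t ht) (hne t ht) h3]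
      simp
  have htop : LinearMap.ker (Matrix.toLin' (P - c • (1 : Matrix ι ι ℂ))) = ⊤ := by
    rw [eq_top_iff, ← Module.End.iSup_maxGenEigenspace_eq_top (Matrix.toLin' A)]
    exact iSup_le hle
  have h0 : P - c • (1 : Matrix ι ι ℂ) = 0 := by
    exact Matrix.toLin'.map_eq_zero_iff.1 (LinearMap.ker_eq_top.1 htop)
  have := congrFun (congrFun (sub_eq_zero.1 h0) i) j
  simpa [P, Matrix.one_apply] using this

end Resolvent

/-! ### Sylvester equations with dissipative coefficients -/

section Sylvester

/-- For singular `M` both inverses are the default value `0`, so no invertibility has to be carried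
along. -/
theorem matrix_inv_neg {κ : Type*} [Fintype κ] [DecidableEq κ] (M : Matrix κ κ ℂ) :
    (-M)⁻¹ = -M⁻¹ := by
  by_cases h : IsUnit M.det
  · apply Matrix.inv_eq_right_inv
    rw [neg_mul_neg, Matrix.mul_nonsing_inv _ h]
  · have h' : ¬ IsUnit (-M).det := by
      rw [← Matrix.isUnit_iff_isUnit_det, IsUnit.neg_iff, Matrix.isUnit_iff_isUnit_det]
      exact h
    rw [Matrix.nonsing_inv_apply_not_isUnit _ h, Matrix.nonsing_inv_apply_not_isUnit _ h', neg_zero]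

open Set ComplexConjugate

variable {ι κ : Type*} [Fintype ι] [Fintype κ]

/-- The matrix `A`, conjugated with the positive weights `p`, is dissipative with rate `a`. -/
def IsDissipative (A : Matrix ι ι ℂ) (p : ι → ℝ) (a : ℝ) : Prop :=
  ∀ w : ι → ℂ, (∑ i, ∑ j, conj (w i) * (((p i)⁻¹ : ℝ) * A i j * (p j : ℝ)) * w j).re
    ≤ -a * ∑ i, ‖w i‖ ^ 2

/-- The left-hand side of the Sylvester equation `ε X - A X - X Dᴴ = Y`. -/
def sylvester (A : Matrix ι ι ℂ) (D : Matrix κ κ ℂ) (ε : ℝ) :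
    Matrix ι κ ℂ →ₗ[ℂ] Matrix ι κ ℂ where
  toFun X := (ε : ℂ) • X - A * X - X * Dᴴ
  map_add' X Y := by
    rw [smul_add, Matrix.mul_add, Matrix.add_mul]
    abel
  map_smul' c X := by
    simp only [RingHom.id_apply, Matrix.mul_smul, Matrix.smul_mul, smul_sub, smul_comm c]

theorem sylvester_apply (A : Matrix ι ι ℂ) (D : Matrix κ κ ℂ) (ε : ℝ) (X : Matrix ι κ ℂ) (i : ι)
    (j : κ) : sylvester A D ε X i j
      = ε * X i j - ∑ k, A i k * X k j - ∑ l, X i l * conj (D j l) := by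
  simp [sylvester, Matrix.mul_apply]

variable {A : Matrix ι ι ℂ} {D : Matrix κ κ ℂ} {p : ι → ℝ} {q : κ → ℝ} {a ε : ℝ}

/-- Energy estimate: take the real part of the pairing of the equation with the weighted solution `V
= X / (p q)`. The columns of `V` feel `A`, the rows feel `D`, each contributing `a ∑ ‖V i j‖²`, and
the `ε` term has a good sign. -/
theorem IsDissipative.sylvester_le (hA : IsDissipative A p a) (hD : IsDissipative D q a)
    (hp : ∀ i, 0 < p i) (hq : ∀ j, 0 < q j) (hε : 0 ≤ ε) (X : Matrix ι κ ℂ) :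
    2 * a * ∑ i, ∑ j, ‖X i j / (p i * q j : ℝ)‖ ^ 2
      ≤ ∑ i, ∑ j, ‖X i j / (p i * q j : ℝ)‖ * ‖sylvester A D ε X i j / (p i * q j : ℝ)‖ := by
  set V : Matrix ι κ ℂ := Matrix.of fun i j => X i j / (p i * q j : ℝ) with hV
  have hX : ∀ i j, X i j = V i j * (p i * q j) := by
    intro i j
    have h1 : (p i : ℂ) ≠ 0 := by exact_mod_cast (hp i).ne'
    have h2 : (q j : ℂ) ≠ 0 := by exact_mod_cast (hq j).ne'
    simp only [hV, Matrix.of_apply]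
    push_cast
    field_simp
  have hid : ∀ i j, sylvester A D ε X i j / (p i * q j : ℝ)
      = ε * V i j - ∑ k, ((p i)⁻¹ : ℝ) * A i k * (p k : ℝ) * V k j
        - ∑ l, V i l * conj (((q j)⁻¹ : ℝ) * D j l * (q l : ℝ)) := by
    intro i j
    have h1 : (p i : ℂ) ≠ 0 := by exact_mod_cast (hp i).ne'
    have h2 : (q j : ℂ) ≠ 0 := by exact_mod_cast (hq j).ne'
    rw [sylvester_apply, sub_div, sub_div, Finset.sum_div, Finset.sum_div]
    congr 1
    · congr 1
      · rw [hX]; push_cast; field_simp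
      · refine Finset.sum_congr rfl fun k _ => ?_
        rw [hX]; push_cast; field_simp
    · refine Finset.sum_congr rfl fun k _ => ?_
      rw [hX]
      simp only [map_mul, Complex.conj_ofReal]
      push_cast; field_simp
  have hmain : (∑ i, ∑ j, conj (V i j) * (sylvester A D ε X i j / (p i * q j : ℝ))).re
      = ε * ∑ i, ∑ j, ‖V i j‖ ^ 2
        - ∑ j, (∑ i, ∑ k, conj (V i j) * (((p i)⁻¹ : ℝ) * A i k * (p k : ℝ)) * V k j).re
        - ∑ i, (∑ j, ∑ l, conj (conj (V i j)) * (((q j)⁻¹ : ℝ) * D j l * (q l : ℝ))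
            * conj (V i l)).re := by
    have e1 : ∀ i j, conj (V i j) * (sylvester A D ε X i j / (p i * q j : ℝ))
        = ε * ((‖V i j‖ ^ 2 : ℝ) : ℂ)
          - ∑ k, conj (V i j) * (((p i)⁻¹ : ℝ) * A i k * (p k : ℝ)) * V k j
          - ∑ l, conj (conj (conj (V i j)) * (((q j)⁻¹ : ℝ) * D j l * (q l : ℝ))
            * conj (V i l)) := by
      intro i j
      rw [hid, mul_sub, mul_sub, Finset.mul_sum, Finset.mul_sum]
      congr 1
      · congr 1
        · rw [mul_left_comm, ← Complex.normSq_eq_conj_mul_self, Complex.normSq_eq_norm_sq]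
        · exact Finset.sum_congr rfl fun k _ => by ring
      · refine Finset.sum_congr rfl fun k _ => ?_
        simp only [map_mul, Complex.conj_conj, Complex.conj_ofReal]
        ring
    simp only [e1, Finset.sum_sub_distrib, Complex.sub_re, Complex.re_sum]
    rw [Finset.mul_sum]
    congr 1
    · congr 1
      · refine Finset.sum_congr rfl fun i _ => ?_
        rw [Finset.mul_sum]
        refine Finset.sum_congr rfl fun j _ => ?_
        rw [← Complex.ofReal_mul, Complex.ofReal_re]
      · rw [Finset.sum_comm]
  have h1 : ∑ j, (∑ i, ∑ k, conj (V i j) * (((p i)⁻¹ : ℝ) * A i k * (p k : ℝ)) * V k j).re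
      ≤ -a * ∑ i, ∑ j, ‖V i j‖ ^ 2 := by
    rw [Finset.sum_comm, Finset.mul_sum]
    exact Finset.sum_le_sum fun j _ => hA fun i => V i j
  -- Right multiplication by `Dᴴ` acts on rows through the conjugate of `D`, so dissipativity is
  -- tested on the conjugated rows of `V`.
  have h2 : ∑ i, (∑ j, ∑ l, conj (conj (V i j)) * (((q j)⁻¹ : ℝ) * D j l * (q l : ℝ))
      * conj (V i l)).re ≤ -a * ∑ i, ∑ j, ‖V i j‖ ^ 2 := by
    rw [Finset.mul_sum]
    refine Finset.sum_le_sum fun i _ => (hD fun j => conj (V i j)).trans_eq ?_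
    simp
  have h3 : (∑ i, ∑ j, conj (V i j) * (sylvester A D ε X i j / (p i * q j : ℝ))).re
      ≤ ∑ i, ∑ j, ‖V i j‖ * ‖sylvester A D ε X i j / (p i * q j : ℝ)‖ := by
    simp only [Complex.re_sum]
    refine Finset.sum_le_sum fun i _ => Finset.sum_le_sum fun j _ => ?_
    refine (Complex.re_le_norm _).trans_eq ?_
    rw [norm_mul, Complex.norm_conj]
  have h4 : 0 ≤ ε * ∑ i, ∑ j, ‖V i j‖ ^ 2 := by positivity
  have h5 : 2 * a * ∑ i, ∑ j, ‖V i j‖ ^ 2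
      ≤ ∑ i, ∑ j, ‖V i j‖ * ‖sylvester A D ε X i j / (p i * q j : ℝ)‖ := by linarith
  exact h5

theorem IsDissipative.sylvester_injective (hA : IsDissipative A p a) (hD : IsDissipative D q a)
    (hp : ∀ i, 0 < p i) (hq : ∀ j, 0 < q j) (ha : 0 < a) (hε : 0 ≤ ε) :
    Function.Injective (sylvester A D ε) := by
  rw [injective_iff_map_eq_zero]
  intro X hX
  have h := hA.sylvester_le hD hp hq hε X
  simp only [hX, Matrix.zero_apply, zero_div, norm_zero, mul_zero, Finset.sum_const_zero] at h
  have h0 : ∑ i, ∑ j, ‖X i j / (p i * q j : ℝ)‖ ^ 2 = 0 := by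
    have : 0 ≤ ∑ i, ∑ j, ‖X i j / (p i * q j : ℝ)‖ ^ 2 := by positivity
    nlinarith
  ext i j
  have h1 := (Finset.sum_eq_zero_iff_of_nonneg (fun i _ => by positivity)).1 h0 i (Finset.mem_univ i)
  have h2 := (Finset.sum_eq_zero_iff_of_nonneg (fun i _ => by positivity)).1 h1 j (Finset.mem_univ j)
  have h3 : (p i * q j : ℝ) ≠ 0 := (mul_pos (hp i) (hq j)).ne'
  have h4 : ((p i * q j : ℝ) : ℂ) ≠ 0 := by exact_mod_cast h3
  have h5 : X i j / (p i * q j : ℝ) = 0 := by simpa only [sq_eq_zero_iff, norm_eq_zero] using h2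
  simpa using (div_eq_zero_iff.1 h5).resolve_right h4

/-- Exponential localisation of the Green function of a Sylvester equation. -/
theorem IsDissipative.norm_le_of_sylvester_eq_single [DecidableEq ι] [DecidableEq κ]
    (hA : IsDissipative A p a) (hD : IsDissipative D q a)
    (hp : ∀ i, 0 < p i) (hq : ∀ j, 0 < q j) (ha : 0 < a) (hε : 0 ≤ ε) {X : Matrix ι κ ℂ}
    {u : ι} {v : κ} (hX : sylvester A D ε X = Matrix.single u v 1) (x : ι) (y : κ) :
    ‖X x y‖ ≤ (2 * a)⁻¹ * ((p x * q y) / (p u * q v)) := by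
  have h := hA.sylvester_le hD hp hq hε X
  set V : ι → κ → ℝ := fun i j => ‖X i j / (p i * q j : ℝ)‖ with hV
  have hr : ∑ i, ∑ j, ‖X i j / (p i * q j : ℝ)‖ * ‖sylvester A D ε X i j / (p i * q j : ℝ)‖
      = V u v * (p u * q v)⁻¹ := by
    rw [Finset.sum_eq_single u, Finset.sum_eq_single v]
    · simp [hX, hV, abs_of_pos (hp u), abs_of_pos (hq v)]
    · intro j _ hj
      simp [hX, hj.symm]
    · simp
    · intro i _ hi
      refine Finset.sum_eq_zero fun j _ => ?_
      simp [hX, hi.symm]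
    · simp
  rw [hr] at h
  set F := ∑ i, ∑ j, ‖X i j / (p i * q j : ℝ)‖ ^ 2 with hF
  have hle : ∀ i j, V i j ^ 2 ≤ F := by
    intro i j
    have h1 : ∑ j, V i j ^ 2 ≤ F :=
      Finset.single_le_sum (f := fun i => ∑ j, V i j ^ 2) (fun i _ => by positivity)
        (Finset.mem_univ i)
    exact (Finset.single_le_sum (f := fun j => V i j ^ 2) (fun i _ => by positivity)
      (Finset.mem_univ j)).trans h1
  have hF0 : 0 ≤ F := by positivity
  set c := (p u * q v)⁻¹ with hc
  have hc0 : 0 < c := inv_pos.2 (mul_pos (hp u) (hq v))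
  -- The energy estimate reads `2aF ≤ V u v * c`, and a single entry is at most `√F`; dividing by
  -- `√F` bounds the whole Frobenius norm.
  have hs : Real.sqrt F ≤ (2 * a)⁻¹ * c := by
    have h1 : V u v ≤ Real.sqrt F := Real.le_sqrt_of_sq_le (hle u v)
    have h2 : Real.sqrt F * (2 * a * Real.sqrt F) ≤ Real.sqrt F * c := by
      have := Real.mul_self_sqrt hF0
      nlinarith
    rcases (Real.sqrt_nonneg F).eq_or_lt with h0 | h0
    · rw [← h0]; positivity
    · rw [inv_mul_eq_div, le_div_iff₀ (by positivity)]
      linarith [le_of_mul_le_mul_left h2 h0]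
  have h1 : V x y ≤ (2 * a)⁻¹ * c := (Real.le_sqrt_of_sq_le (hle x y)).trans hs
  have h2 : ‖X x y‖ = V x y * (p x * q y) := by
    have := hp x
    have := hq y
    simp only [hV, norm_div, Complex.norm_real, Real.norm_eq_abs]
    rw [abs_of_pos (by positivity)]
    field_simp
  rw [h2, div_eq_mul_inv, ← hc]
  have := mul_le_mul_of_nonneg_right h1 (mul_pos (hp x) (hq y)).le
  linarith

/-- Solutions of a Sylvester equation are bounded by the exponentially localised source. -/
theorem IsDissipative.norm_le_sum_sylvester
    (hA : IsDissipative A p a) (hD : IsDissipative D q a)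
    (hp : ∀ i, 0 < p i) (hq : ∀ j, 0 < q j) (ha : 0 < a) (hε : 0 ≤ ε) (X : Matrix ι κ ℂ)
    (x : ι) (y : κ) :
    ‖X x y‖ ≤ ∑ u, ∑ v, (2 * a)⁻¹ * ((p x * q y) / (p u * q v)) * ‖sylvester A D ε X u v‖ := by
  classical
  have hinj := hA.sylvester_injective hD hp hq ha hε
  have hsurj := LinearMap.injective_iff_surjective.1 hinj
  -- `G` collects the Green matrices, available because an injective map of a finite-dimensional
  -- space is onto; `X` is then their superposition.
  choose G hG using fun uv : ι × κ => hsurj (Matrix.single uv.1 uv.2 1)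
  have hX : X = ∑ u, ∑ v, sylvester A D ε X u v • G (u, v) := by
    apply hinj
    simp only [map_sum, map_smul, hG]
    conv_lhs => rw [Matrix.matrix_eq_sum_single (sylvester A D ε X)]
    simp
  conv_lhs => rw [hX]
  simp only [Matrix.sum_apply, Matrix.smul_apply, smul_eq_mul]
  refine (norm_sum_le _ _).trans (Finset.sum_le_sum fun u _ => ?_)
  refine (norm_sum_le _ _).trans (Finset.sum_le_sum fun v _ => ?_)
  rw [norm_mul, mul_comm]
  exact mul_le_mul_of_nonneg_right
    (hA.norm_le_of_sylvester_eq_single hD hp hq ha hε (hG (u, v)) x y) (norm_nonneg _)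

/-- Pairing an eigenvector with its eigenvalue equation puts the spectrum of `ε - Aᴴ` strictly to
the right of `Re z = ε` when `a > 0`, hence outside every admissible contour. -/
theorem IsDissipative.re_le_of_mem_spectrum_conjTranspose [DecidableEq ι]
    (hA : IsDissipative A (fun _ => 1) a) {w : ℂ}
    (hw : w ∈ spectrum ℂ ((ε : ℂ) • (1 : Matrix ι ι ℂ) - Aᴴ)) : ε + a ≤ w.re := by
  rw [← Matrix.spectrum_toLin', ← Module.End.hasEigenvalue_iff_mem_spectrum] at hw
  obtain ⟨v, hv⟩ := hw.exists_hasEigenvector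
  have hv1 := hv.apply_eq_smul
  rw [Matrix.toLin'_apply, Matrix.sub_mulVec, Matrix.smul_mulVec, Matrix.one_mulVec] at hv1
  have hpos : 0 < ∑ i, ‖v i‖ ^ 2 := by
    obtain ⟨i, hi⟩ := Function.ne_iff.1 hv.2
    exact Finset.sum_pos' (fun i _ => by positivity)
      ⟨i, Finset.mem_univ i, by have := norm_pos_iff.2 hi; positivity⟩
  have h1 : ∀ i, w * ((‖v i‖ ^ 2 : ℝ) : ℂ)
      = ε * ((‖v i‖ ^ 2 : ℝ) : ℂ) - ∑ j, conj (conj (v j) * (((1 : ℝ)⁻¹ : ℝ) * A j i * (1 : ℝ)) * v i) := by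
    intro i
    have h2 := congrFun hv1 i
    simp only [Pi.sub_apply, Pi.smul_apply, smul_eq_mul, Matrix.mulVec, dotProduct,
      Matrix.conjTranspose_apply] at h2
    rw [← Complex.normSq_eq_norm_sq, Complex.normSq_eq_conj_mul_self, mul_left_comm, ← h2, mul_sub,
      Finset.mul_sum]
    congr 1
    · ring
    · refine Finset.sum_congr rfl fun j _ => ?_
      simp
      ring
  have h3 := congrArg Complex.re (Finset.sum_congr (rfl : Finset.univ = Finset.univ)
    fun i (_ : i ∈ Finset.univ) => h1 i)
  rw [Finset.sum_sub_distrib, ← Finset.mul_sum, ← Finset.mul_sum, Finset.sum_comm] at h3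
  have h4 := hA v
  simp only [← map_sum, Complex.sub_re, Complex.conj_re, ← Complex.ofReal_sum,
    Complex.re_mul_ofReal, ← Complex.ofReal_mul, Complex.ofReal_re] at h3
  by_contra hlt
  push Not at hlt
  have := mul_lt_mul_of_pos_right hlt hpos
  linarith

/-- The contour integral in the definition of the kernel solves a Sylvester equation. -/
theorem sylvester_contourIntegral_eq_single [DecidableEq ι] [DecidableEq κ] {Γ : ℝ → ℂ}
    (h : IsContour Γ) (hre : ∀ t ∈ Icc (0 : ℝ) 1, (Γ t).re < ε)
    (hw : WindsOnceAround Γ (spectrum ℂ A)) (hD : IsDissipative D (fun _ => 1) a) (ha : 0 < a)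
    (u : ι) (v : κ) :
    sylvester A D ε (Matrix.of fun i j => contourIntegral Γ fun z =>
        (z • (1 : Matrix ι ι ℂ) - A)⁻¹ i u * (((ε : ℂ) - z) • (1 : Matrix κ κ ℂ) - Dᴴ)⁻¹ v j)
      = Matrix.single u v 1 := by
  set RA : ℂ → Matrix ι ι ℂ := fun z => (z • (1 : Matrix ι ι ℂ) - A)⁻¹ with hRA
  set RB : ℂ → Matrix κ κ ℂ := fun z => (((ε : ℂ) - z) • (1 : Matrix κ κ ℂ) - Dᴴ)⁻¹ with hRB
  have hA' : ∀ t ∈ Icc (0 : ℝ) 1, Γ t ∉ spectrum ℂ A := fun t ht hm => (hw _ hm).1 t ht rfl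
  -- Since `(ε - z) - Dᴴ = -(z - E)`, the second resolvent is minus the resolvent of `E`, whose
  -- spectrum the contour does not enclose.
  set E : Matrix κ κ ℂ := (ε : ℂ) • (1 : Matrix κ κ ℂ) - Dᴴ with hE
  have hEre : ∀ w ∈ spectrum ℂ E, ∀ t ∈ Icc (0 : ℝ) 1, (Γ t).re < w.re := by
    intro w hw t ht
    have := hD.re_le_of_mem_spectrum_conjTranspose hw
    have := hre t ht
    linarith
  have hE' : ∀ t ∈ Icc (0 : ℝ) 1, Γ t ∉ spectrum ℂ E :=
    fun t ht hm => lt_irrefl _ (hEre _ hm t ht)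
  have hRBE : ∀ z, RB z = -(z • (1 : Matrix κ κ ℂ) - E)⁻¹ := by
    intro z
    have : ((ε : ℂ) - z) • (1 : Matrix κ κ ℂ) - Dᴴ = -(z • (1 : Matrix κ κ ℂ) - E) := by
      rw [hE, sub_smul]; abel
    rw [hRB]
    simp only [this]
    exact matrix_inv_neg _
  have cA : ∀ i j, ContinuousOn (fun t => RA (Γ t) i j) (Icc 0 1) :=
    h.continuousOn_resolvent hA'
  have cB : ∀ i j, ContinuousOn (fun t => RB (Γ t) i j) (Icc 0 1) := by
    intro i j
    simp only [hRBE, Matrix.neg_apply]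
    exact (h.continuousOn_resolvent hE' i j).neg
  have iA : ∀ i j, contourIntegral Γ (fun z => RA z i j) = if i = j then 1 else 0 :=
    contourIntegral_resolvent h hw
  have iB : ∀ i j, contourIntegral Γ (fun z => RB z i j) = 0 := by
    intro i j
    simp only [hRBE, Matrix.neg_apply]
    rw [contourIntegral_neg, contourIntegral_resolvent h (c := 0)]
    · simp
    · intro w hw
      exact ⟨fun t ht e => hE' t ht (e ▸ hw), contourIntegral_inv_eq_zero h (hEre w hw)⟩
  ext i j
  rw [sylvester_apply]
  simp only [Matrix.of_apply]
  have s1 : ∑ k, A i k * contourIntegral Γ (fun z => RA z k u * RB z v j)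
      = contourIntegral Γ (fun z => ∑ k, A i k * (RA z k u * RB z v j)) := by
    rw [contourIntegral_sum h]
    · simp only [contourIntegral_const_mul]
    · exact fun k _ => continuousOn_const.mul ((cA k u).mul (cB v j))
  have s2 : ∑ l, contourIntegral Γ (fun z => RA z i u * RB z v l) * conj (D j l)
      = contourIntegral Γ (fun z => ∑ l, (RA z i u * RB z v l) * conj (D j l)) := by
    rw [contourIntegral_sum h]
    · simp only [contourIntegral_mul_const]
    · exact fun k _ => ((cA i u).mul (cB v k)).mul continuousOn_const
  rw [s1, s2, ← contourIntegral_const_mul, sub_sub, ← contourIntegral_add h, sub_eq_add_neg,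
    ← contourIntegral_neg, ← contourIntegral_add h]
  rotate_left
  · exact continuousOn_const.mul ((cA i u).mul (cB v j))
  · exact ((continuousOn_finsetSum _ fun k _ => continuousOn_const.mul
      ((cA k u).mul (cB v j))).add (continuousOn_finsetSum _ fun k _ =>
        ((cA i u).mul (cB v k)).mul continuousOn_const)).neg
  · exact continuousOn_finsetSum _ fun k _ => continuousOn_const.mul ((cA k u).mul (cB v j))
  · exact continuousOn_finsetSum _ fun k _ => ((cA i u).mul (cB v k)).mul continuousOn_const
  -- Writing `ε = z + (ε - z)` turns the integrand into `(z - A) R_A R_B + R_A R_B (ε - z - Dᴴ)`,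
  -- where each factor cancels a resolvent. The remaining `R_B` integrates to zero and `R_A` to the
  -- identity.
  rw [contourIntegral_congr (g := fun z => (1 : Matrix ι ι ℂ) i u * RB z v j
    + RA z i u * (1 : Matrix κ κ ℂ) v j), contourIntegral_add h, contourIntegral_const_mul,
    contourIntegral_mul_const, iA, iB]
  · simp only [Matrix.one_apply, Matrix.single_apply]
    rcases eq_or_ne i u with rfl | hi
    · simp
    · simp [hi, hi.symm]
  · exact continuousOn_const.mul (cB v j)
  · exact (cA i u).mul continuousOn_const
  · intro t ht
    have hA1 : (Γ t • (1 : Matrix ι ι ℂ) - A) * RA (Γ t) = 1 :=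
      Matrix.mul_nonsing_inv _ (isUnit_det_smul_one_sub (hA' t ht))
    have hB1 : RB (Γ t) * (((ε : ℂ) - Γ t) • (1 : Matrix κ κ ℂ) - Dᴴ) = 1 := by
      apply Matrix.nonsing_inv_mul
      have := (isUnit_det_smul_one_sub (hE' t ht))
      rw [← Matrix.isUnit_iff_isUnit_det] at this ⊢
      convert this.neg using 1
      rw [hE, sub_smul]; abel
    have hA2 := congrFun (congrFun hA1 i) u
    have hB2 := congrFun (congrFun hB1 v) j
    rw [Matrix.sub_mul, Matrix.smul_mul, Matrix.one_mul, Matrix.sub_apply, Matrix.smul_apply,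
      Matrix.mul_apply, smul_eq_mul] at hA2
    rw [Matrix.mul_sub, Matrix.mul_smul, Matrix.mul_one, Matrix.sub_apply, Matrix.smul_apply,
      Matrix.mul_apply, smul_eq_mul] at hB2
    rw [← hA2, ← hB2]
    have e1 : ∑ k, A i k * (RA (Γ t) k u * RB (Γ t) v j)
        = (∑ k, A i k * RA (Γ t) k u) * RB (Γ t) v j := by
      simp only [Finset.sum_mul, mul_assoc]
    have e2 : ∑ l, RA (Γ t) i u * RB (Γ t) v l * conj (D j l)
        = RA (Γ t) i u * ∑ l, RB (Γ t) v l * Dᴴ l j := by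
      rw [Finset.mul_sum]
      exact Finset.sum_congr rfl fun l _ => mul_assoc _ _ _
    rw [e1, e2]
    ring

end Sylvester

/-! ### Geometry of the lattice -/

section Geometry

theorem gdist_nonneg (x y : Λ) : 0 ≤ gdist x y := Nat.cast_nonneg _

theorem gdist_comm (x y : Λ) : gdist x y = gdist y x := by
  rw [gdist, gdist, SimpleGraph.dist_comm]

theorem gdist_self (x : Λ) : gdist x x = 0 := by simp [gdist]

theorem gdist_triangle {x y : Λ} (h : FiniteDist x y) (z : Λ) :
    gdist x z ≤ gdist x y + gdist y z := by
  unfold gdist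
  exact_mod_cast SimpleGraph.Reachable.dist_triangle_left h z

theorem one_le_gdist {x y : Λ} (h : FiniteDist x y) (hne : x ≠ y) : 1 ≤ gdist x y := by
  unfold gdist
  exact_mod_cast SimpleGraph.Reachable.pos_dist_of_ne h hne

theorem mem_ball {x u : Λ} {r : ℝ} : u ∈ ball x r ↔ FiniteDist x u ∧ gdist x u ≤ r := by
  simp [ball]

theorem mem_third {x y u : Λ} : u ∈ third x y ↔ FiniteDist x u ∧ gdist x u ≤ gdist x y / 3 :=
  mem_ball

theorem abs_sub_le_gdist {x y : Λ} (h : FiniteDist x y) (i : Fin n) :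
    (|x.1 i - y.1 i| : ℝ) ≤ gdist x y := by
  obtain ⟨p, hp⟩ := h.exists_walk_length_eq_dist
  have := abs_sub_le_walk_length p i
  rw [hp] at this
  rw [gdist]
  exact_mod_cast this

theorem summable_exp_neg_mul_abs_int {μ : ℝ} (hμ : 0 < μ) :
    Summable fun k : ℤ => Real.exp (-μ * |(k : ℝ)|) := by
  have h : Summable fun k : ℕ => Real.exp (-μ * (k : ℝ)) := by
    simp_rw [mul_comm (-μ), Real.exp_nat_mul]
    exact summable_geometric_of_lt_one (Real.exp_pos _).le (by simpa using hμ)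
  refine Summable.of_nat_of_neg ?_ ?_ <;> simpa using h

/-- The exponential of minus the distance is summable, uniformly in the subset of the lattice. -/
theorem exists_sum_exp_gdist_le (n : ℕ) {μ : ℝ} (hμ : 0 < μ) :
    ∃ S : ℝ, 0 < S ∧ ∀ (Λ : Set (Fin n → ℤ)) (x : Λ) (s : Finset Λ), (∀ u ∈ s, FiniteDist x u) →
      ∑ u ∈ s, Real.exp (-μ * gdist x u) ≤ S := by
  classical
  -- Every coordinate difference is at most `d`, so `exp(-μ d)` is dominated by a product of
  -- one-dimensional exponentials at rate `μ / (n + 1)`; the `+ 1` also covers `n = 0`.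
  have hν : 0 < μ / (n + 1) := by positivity
  set f : ℤ → ℝ := fun k => Real.exp (-(μ / (n + 1)) * |(k : ℝ)|) with hf
  have hsum : Summable f := summable_exp_neg_mul_abs_int hν
  have hS : 0 < ∑' k, f k := hsum.tsum_pos (fun _ => (Real.exp_pos _).le) 0 (Real.exp_pos _)
  refine ⟨(∑' k, f k) ^ n, pow_pos hS n, fun Λ x s hs => ?_⟩
  have hinj : Set.InjOn (fun (u : Λ) (i : Fin n) => x.1 i - u.1 i) s := by
    intro u _ v _ h
    ext i
    simpa using congrFun h i
  set t := s.image fun (u : Λ) (i : Fin n) => x.1 i - u.1 i with ht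
  calc ∑ u ∈ s, Real.exp (-μ * gdist x u)
      ≤ ∑ u ∈ s, ∏ i, f (x.1 i - u.1 i) := by
        refine Finset.sum_le_sum fun u hu => ?_
        rw [hf, ← Real.exp_sum, Real.exp_le_exp, ← Finset.mul_sum]
        have h1 : ∑ i : Fin n, |((x.1 i - u.1 i : ℤ) : ℝ)| ≤ n * gdist x u := by
          have := Finset.sum_le_sum fun i (_ : i ∈ Finset.univ) => abs_sub_le_gdist (hs u hu) i
          simpa using this
        have h2 := gdist_nonneg x u
        have h3 : μ / (n + 1) * ∑ i : Fin n, |((x.1 i - u.1 i : ℤ) : ℝ)|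
            ≤ μ / (n + 1) * ((n + 1) * gdist x u) :=
          mul_le_mul_of_nonneg_left (h1.trans (by nlinarith)) hν.le
        have h4 : μ / (n + 1) * ((n + 1) * gdist x u) = μ * gdist x u := by field_simp
        linarith
    _ = ∑ z ∈ t, ∏ i, f (z i) := by rw [ht, Finset.sum_image hinj]
    _ ≤ ∑ z ∈ Fintype.piFinset fun i => t.image fun z => z i, ∏ i, f (z i) := by
        refine Finset.sum_le_sum_of_subset_of_nonneg ?_ fun z _ _ =>
          Finset.prod_nonneg fun i _ => (Real.exp_pos _).le
        intro z hz
        exact Fintype.mem_piFinset.2 fun i => Finset.mem_image_of_mem _ hz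
    _ = ∏ i, ∑ k ∈ t.image fun z => z i, f k := (Finset.prod_univ_sum _ _).symm
    _ ≤ ∏ _i : Fin n, ∑' k, f k :=
        Finset.prod_le_prod (fun i _ => Finset.sum_nonneg fun k _ => (Real.exp_pos _).le)
          fun i _ => hsum.sum_le_tsum _ fun k _ => (Real.exp_pos _).le
    _ = (∑' k, f k) ^ n := by simp

/-- Each point of the ball contributes at least `exp(-R)` to a sum bounded uniformly in `Λ` and `x`.
-/
theorem exists_card_ball_le (n : ℕ) (R : ℝ) :
    ∃ m : ℕ, ∀ (Λ : Set (Fin n → ℤ)) (x : Λ), (ball x R).card ≤ m := by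
  obtain ⟨S, hS, h⟩ := exists_sum_exp_gdist_le n one_pos
  refine ⟨⌊Real.exp R * S⌋₊, fun Λ x => Nat.le_floor ?_⟩
  have h1 : ∑ _u ∈ ball x R, Real.exp (-R) ≤ S := by
    refine le_trans (Finset.sum_le_sum fun u hu => ?_) (h Λ x (ball x R) fun u hu => (mem_ball.1 hu).1)
    rw [Real.exp_le_exp]
    have := (mem_ball.1 hu).2
    linarith
  rw [Finset.sum_const, nsmul_eq_mul] at h1
  have h2 := mul_le_mul_of_nonneg_left h1 (Real.exp_pos R).le
  rwa [mul_left_comm, ← Real.exp_add, add_neg_cancel, Real.exp_zero, mul_one] at h2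

/-- All such sets are subsets of one ball. This is the finite-overlap property behind every sum over
`Z`. -/
theorem card_le_two_pow_of_mem {R : ℝ} {m : ℕ} {x : Λ} (hm : (ball x R).card ≤ m)
    (F : Finset (Finset Λ)) (hF : ∀ Z ∈ F, x ∈ Z ∧ DiamLE Z R) : F.card ≤ 2 ^ m := by
  have hsub : F ⊆ (ball x R).powerset := fun Z hZ => Finset.mem_powerset.2 fun u hu =>
    mem_ball.2 ((hF Z hZ).2 x (hF Z hZ).1 u hu)
  calc F.card ≤ (ball x R).powerset.card := Finset.card_le_card hsub
    _ = 2 ^ (ball x R).card := Finset.card_powerset _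
    _ ≤ 2 ^ m := Nat.pow_le_pow_right two_pos hm

end Geometry

/-! ### Matrix elements and strongly convergent series -/

section StrongSums

theorem inner_delta_left (x : Λ) (f : Ell2 Λ) : ⟪δ x, f⟫_ℂ = f x := by
  simp [δ, lp.inner_single_left]

theorem inner_delta_right (x : Λ) (f : Ell2 Λ) : ⟪f, δ x⟫_ℂ = (starRingEnd ℂ) (f x) := by
  rw [← inner_conj_symm, inner_delta_left]

theorem norm_delta (x : Λ) : ‖δ x‖ = 1 := by
  simp [δ, lp.norm_single]

theorem delta_apply (x y : Λ) : δ x y = if y = x then 1 else 0 := by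
  by_cases h : y = x
  · subst h; simp [δ]
  · simp [δ, h]

theorem elt_eq_apply (A : Op Λ) (x y : Λ) : elt A x y = A (δ y) x := inner_delta_left _ _

theorem norm_elt_le (A : Op Λ) (x y : Λ) : ‖elt A x y‖ ≤ ‖A‖ := by
  refine (norm_inner_le_norm _ _).trans ?_
  simpa [norm_delta] using A.le_opNorm (δ y)

theorem hasSum_smul_delta (f : Ell2 Λ) : HasSum (fun x => f x • δ x) f := by
  have := lp.hasSum_single (p := 2) (by simp) f
  convert this using 2 with x
  rw [δ, ← lp.single_smul]
  simp

theorem hasSum_norm_sq (f : Ell2 Λ) : HasSum (fun x => ‖f x‖ ^ 2) (‖f‖ ^ 2) := by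
  simpa using lp.hasSum_norm (p := 2) (by simp) f

theorem op_ext {A B : Op Λ} (h : ∀ x y, elt A x y = elt B x y) : A = B := by
  ext1 f
  refine HasSum.unique ((hasSum_smul_delta f).mapL A) ?_
  convert (hasSum_smul_delta f).mapL B using 2 with y
  rw [map_smul, map_smul]
  congr 1
  ext x
  simpa only [elt_eq_apply] using h x y

theorem proj_apply (Z : Finset Λ) (f : Ell2 Λ) : proj Z f = ∑ v ∈ Z, f v • δ v := by
  simp [proj, inner_delta_left]

theorem proj_apply_apply (Z : Finset Λ) (f : Ell2 Λ) (x : Λ) [Decidable (x ∈ Z)] :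
    proj Z f x = if x ∈ Z then f x else 0 := by
  classical
  rw [← inner_delta_left x, proj_apply, inner_sum]
  simp [inner_smul_right, inner_delta_left, delta_apply]

theorem norm_proj_sq (Z : Finset Λ) (f : Ell2 Λ) : ‖proj Z f‖ ^ 2 = ∑ v ∈ Z, ‖f v‖ ^ 2 := by
  classical
  refine (hasSum_norm_sq (proj Z f)).unique ?_
  have : ∑ v ∈ Z, ‖f v‖ ^ 2 = ∑ v ∈ Z, ‖proj Z f v‖ ^ 2 :=
    Finset.sum_congr rfl fun v hv => by rw [proj_apply_apply, if_pos hv]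
  rw [this]
  exact hasSum_sum_of_ne_finset_zero fun v hv => by rw [proj_apply_apply, if_neg hv]; simp

theorem inner_proj_left (Z : Finset Λ) (f g : Ell2 Λ) : ⟪proj Z f, g⟫_ℂ = ⟪f, proj Z g⟫_ℂ := by
  simp only [proj_apply, sum_inner, inner_sum, inner_smul_left, inner_smul_right,
    inner_delta_left, inner_delta_right, mul_comm]

theorem proj_delta_of_mem {Z : Finset Λ} {y : Λ} (hy : y ∈ Z) : proj Z (δ y) = δ y := by
  rw [proj_apply, Finset.sum_eq_single y]
  · simp [delta_apply]
  · intro v _ hv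
    simp [delta_apply, hv]
  · exact fun h => (h hy).elim

theorem proj_delta_of_notMem {Z : Finset Λ} {y : Λ} (hy : y ∉ Z) : proj Z (δ y) = 0 := by
  rw [proj_apply]
  refine Finset.sum_eq_zero fun v hv => ?_
  rw [delta_apply, if_neg (ne_of_mem_of_not_mem hv hy), zero_smul]

/-- The operator `B` acts inside the finite set `Z`. -/
def ActsIn (B : Op Λ) (Z : Finset Λ) : Prop := proj Z * B = B ∧ B * proj Z = B

theorem actsIn_of_opSupport_subset {B : Op Λ} {Z : Finset Λ} (h : opSupport B ⊆ Z) :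
    ActsIn B Z := by
  classical
  constructor
  · refine op_ext fun x y => ?_
    rw [elt_eq_apply, elt_eq_apply, mul_apply_eq_comp, proj_apply_apply]
    split_ifs with hx
    · rfl
    · by_contra hne
      exact hx (h ⟨y, Or.inr (by rw [elt_eq_apply]; exact fun e => hne e.symm)⟩)
  · refine op_ext fun x y => ?_
    by_cases hy : y ∈ Z
    · rw [elt, elt, mul_apply_eq_comp, proj_delta_of_mem hy]
    · rw [elt, mul_apply_eq_comp, proj_delta_of_notMem hy, map_zero, inner_zero_right]
      by_contra hne
      exact hy (h ⟨x, Or.inl fun e => hne e.symm⟩)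

theorem adjoint_proj (Z : Finset Λ) : (proj Z).adjoint = proj Z := by
  refine ContinuousLinearMap.ext fun f => ext_inner_left ℂ fun g => ?_
  rw [ContinuousLinearMap.adjoint_inner_right, inner_proj_left]

namespace ActsIn

variable {A B : Op Λ} {Z : Finset Λ}

theorem mul_mul (hA : ActsIn A Z) (hB : ActsIn B Z) (X : Op Λ) : ActsIn (A * X * B) Z :=
  ⟨by rw [← mul_assoc, ← mul_assoc, hA.1], by rw [mul_assoc, hB.2]⟩

theorem mul (hA : ActsIn A Z) (hB : ActsIn B Z) : ActsIn (A * B) Z := by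
  simpa using hA.mul_mul hB 1

theorem adjoint (hA : ActsIn A Z) : ActsIn A.adjoint Z := by
  have h1 := congrArg ContinuousLinearMap.adjoint hA.1
  have h2 := congrArg ContinuousLinearMap.adjoint hA.2
  rw [ContinuousLinearMap.mul_def, ContinuousLinearMap.adjoint_comp, adjoint_proj] at h1 h2
  exact ⟨h2, h1⟩

theorem sum {ι : Type*} (s : Finset ι) {A : ι → Op Λ} (hA : ∀ i ∈ s, ActsIn (A i) Z) :
    ActsIn (∑ i ∈ s, A i) Z :=
  ⟨by rw [Finset.mul_sum]; exact Finset.sum_congr rfl fun i hi => (hA i hi).1,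
    by rw [Finset.sum_mul]; exact Finset.sum_congr rfl fun i hi => (hA i hi).2⟩

theorem apply_eq_zero (hA : ActsIn A Z) {x : Λ} (hx : x ∉ Z) (f : Ell2 Λ) : A f x = 0 := by
  classical
  rw [← hA.1, mul_apply_eq_comp, proj_apply_apply, if_neg hx]

theorem apply_eq_sum (hA : ActsIn A Z) {W : Finset Λ} (hZ : Z ⊆ W) (f : Ell2 Λ) (x : Λ) :
    A f x = ∑ w ∈ W, elt A x w * f w := by
  have h1 : ∑ w ∈ W, elt A x w * f w = ∑ w ∈ Z, elt A x w * f w := by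
    refine (Finset.sum_subset hZ fun w _ hw => ?_).symm
    rw [← hA.2, elt, mul_apply_eq_comp]
    rw [proj_delta_of_notMem hw, map_zero, inner_zero_right, zero_mul]
  rw [h1]
  conv_lhs => rw [← hA.2, mul_apply_eq_comp, proj_apply, map_sum]
  rw [← inner_delta_left x, inner_sum]
  refine Finset.sum_congr rfl fun w _ => ?_
  rw [map_smul, inner_smul_right, mul_comm, elt]

theorem norm_inner_le (hB : ActsIn B Z) {b : ℝ} (hb : ‖B‖ ≤ b) (f g : Ell2 Λ) :
    ‖⟪f, B g⟫_ℂ‖ ≤ b * (‖proj Z f‖ * ‖proj Z g‖) := by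
  have : ⟪f, B g⟫_ℂ = ⟪proj Z f, B (proj Z g)⟫_ℂ := by
    rw [inner_proj_left]
    conv_lhs => rw [← hB.1, ← hB.2]
    rfl
  rw [this]
  calc ‖⟪proj Z f, B (proj Z g)⟫_ℂ‖ ≤ ‖proj Z f‖ * ‖B (proj Z g)‖ := norm_inner_le_norm _ _
    _ ≤ ‖proj Z f‖ * (b * ‖proj Z g‖) := by
      gcongr
      exact B.le_of_opNorm_le hb _
    _ = _ := by ring

end ActsIn

-- Finite overlap: each site lies in at most `2 ^ m` sets of diameter at most `R`, so its weight `‖f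
-- v‖²` is counted at most that often.
open Classical in
theorem sum_norm_proj_sq_le {R : ℝ} {m : ℕ} (hm : ∀ x : Λ, (ball x R).card ≤ m) (f : Ell2 Λ)
    (F : Finset (Finset Λ)) :
    ∑ Z ∈ F, (if DiamLE Z R then ‖proj Z f‖ ^ 2 else 0) ≤ 2 ^ m * ‖f‖ ^ 2 := by
  rw [← Finset.sum_filter]
  set G := F.filter fun Z => DiamLE Z R with hG
  set U := G.biUnion id with hU
  have h1 : ∀ Z ∈ G, ‖proj Z f‖ ^ 2 = ∑ v ∈ U, if v ∈ Z then ‖f v‖ ^ 2 else 0 := by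
    intro Z hZ
    rw [norm_proj_sq, ← Finset.sum_filter]
    refine Finset.sum_congr ?_ fun _ _ => rfl
    ext v
    simp only [Finset.mem_filter, hU, Finset.mem_biUnion, id]
    exact ⟨fun h => ⟨⟨Z, hZ, h⟩, h⟩, fun h => h.2⟩
  rw [Finset.sum_congr rfl h1, Finset.sum_comm]
  have h2 : ∑ v ∈ U, ‖f v‖ ^ 2 ≤ ‖f‖ ^ 2 :=
    sum_le_hasSum U (fun _ _ => by positivity) (hasSum_norm_sq f)
  refine le_trans ?_ (mul_le_mul_of_nonneg_left h2 (by positivity))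
  rw [Finset.mul_sum]
  refine Finset.sum_le_sum fun v _ => ?_
  rw [← Finset.sum_filter, Finset.sum_const, nsmul_eq_mul]
  gcongr
  have := card_le_two_pow_of_mem (hm v) (G.filter fun Z => v ∈ Z) fun Z hZ =>
    ⟨(Finset.mem_filter.1 hZ).2, (Finset.mem_filter.1 (Finset.mem_filter.1 hZ).1).2⟩
  exact_mod_cast this

-- Pair the sum `w` with itself, apply Cauchy-Schwarz over `Z`, bound the factor containing `w` by
-- finite overlap and cancel `‖w‖²`. The factor containing `f` is kept as a sum over `F`, so that
-- the estimate also controls tails.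
open Classical in
theorem norm_sum_apply_sq_le {R b : ℝ} {m : ℕ} (hm : ∀ x : Λ, (ball x R).card ≤ m)
    {B : Finset Λ → Op Λ} (hB : ∀ Z, ActsIn (B Z) Z) (hb : ∀ Z, ‖B Z‖ ≤ b)
    (h0 : ∀ Z, ¬ DiamLE Z R → B Z = 0) (f : Ell2 Λ) (F : Finset (Finset Λ)) :
    ‖∑ Z ∈ F, B Z f‖ ^ 2
      ≤ b ^ 2 * 2 ^ m * ∑ Z ∈ F, (if DiamLE Z R then ‖proj Z f‖ ^ 2 else 0) := by
  set w := ∑ Z ∈ F, B Z f with hw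
  have hb0 : 0 ≤ b := (norm_nonneg _).trans (hb ∅)
  set a : Ell2 Λ → Finset Λ → ℝ := fun g Z => if DiamLE Z R then ‖proj Z g‖ else 0 with ha
  have hsq : ∀ g Z, a g Z ^ 2 = if DiamLE Z R then ‖proj Z g‖ ^ 2 else 0 := by
    intro g Z
    simp only [ha]
    split_ifs <;> simp
  have h1 : ‖w‖ ^ 2 ≤ b * ∑ Z ∈ F, a w Z * a f Z := by
    have h2 : ‖w‖ ^ 2 = ‖∑ Z ∈ F, ⟪w, B Z f⟫_ℂ‖ := by
      rw [← inner_sum, ← hw, inner_self_eq_norm_sq_to_K]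
      simp
    rw [h2, Finset.mul_sum]
    refine (norm_sum_le _ _).trans (Finset.sum_le_sum fun Z _ => ?_)
    simp only [ha]
    split_ifs with hd
    · exact (hB Z).norm_inner_le (hb Z) w f
    · simp [h0 Z hd]
  have h3 := Finset.sum_mul_sq_le_sq_mul_sq F (a w) (a f)
  simp only [hsq] at h3
  have h4 := sum_norm_proj_sq_le hm w F
  set G := ∑ Z ∈ F, (if DiamLE Z R then ‖proj Z f‖ ^ 2 else 0) with hG
  have hG0 : 0 ≤ G := Finset.sum_nonneg fun Z _ => by split_ifs <;> positivity
  rcases (norm_nonneg w).eq_or_lt with hw0 | hw0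
  · rw [← hw0, zero_pow two_ne_zero]
    exact mul_nonneg (by positivity) hG0
  have h5 : (‖w‖ ^ 2) ^ 2 ≤ b ^ 2 * (2 ^ m * ‖w‖ ^ 2 * G) := by
    calc (‖w‖ ^ 2) ^ 2 ≤ (b * ∑ Z ∈ F, a w Z * a f Z) ^ 2 := by gcongr
      _ = b ^ 2 * (∑ Z ∈ F, a w Z * a f Z) ^ 2 := by ring
      _ ≤ _ := by
        gcongr
        exact h3.trans (mul_le_mul_of_nonneg_right h4 hG0)
  have h6 : ‖w‖ ^ 2 * ‖w‖ ^ 2 ≤ ‖w‖ ^ 2 * (b ^ 2 * 2 ^ m * G) := by linarith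
  exact le_of_mul_le_mul_left h6 (by positivity)

/-- Series of uniformly bounded local operators converge strongly. -/
theorem exists_strong_sum {R b : ℝ} {m : ℕ} (hm : ∀ x : Λ, (ball x R).card ≤ m)
    {B : Finset Λ → Op Λ} (hB : ∀ Z, ActsIn (B Z) Z) (hb : ∀ Z, ‖B Z‖ ≤ b)
    (h0 : ∀ Z, ¬ DiamLE Z R → B Z = 0) :
    ∃ T : Op Λ, ‖T‖ ≤ b * 2 ^ m ∧ ∀ f, HasSum (fun Z => B Z f) (T f) := by
  classical
  have hb0 : 0 ≤ b := (norm_nonneg _).trans (hb ∅)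
  have hsum : ∀ f, Summable fun Z => B Z f := by
    intro f
    have hg : Summable fun Z : Finset Λ => (if DiamLE Z R then ‖proj Z f‖ ^ 2 else 0) :=
      summable_of_sum_le (fun Z => by positivity) (sum_norm_proj_sq_le hm f)
    rw [summable_iff_vanishing_norm] at hg ⊢
    intro ε hε
    -- Tails of `∑ ‖1_Z f‖²` control tails of `∑ B_Z f`; the `+ 1` keeps the denominator positive
    -- when `b = 0`.
    obtain ⟨s, hs⟩ := hg (ε ^ 2 / (b ^ 2 * 2 ^ m + 1)) (by positivity)
    refine ⟨s, fun t ht => ?_⟩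
    have h1 := (le_abs_self _).trans_lt (hs t ht)
    have h2 := norm_sum_apply_sq_le hm hB hb h0 f t
    rw [lt_div_iff₀ (by positivity)] at h1
    have h3 : 0 ≤ ∑ Z ∈ t, (if DiamLE Z R then ‖proj Z f‖ ^ 2 else 0) :=
      Finset.sum_nonneg fun Z _ => by positivity
    refine lt_of_pow_lt_pow_left₀ 2 hε.le ?_
    linarith
  have hbound : ∀ f, ‖∑' Z, B Z f‖ ≤ b * 2 ^ m * ‖f‖ := by
    intro f
    refine le_of_tendsto (hsum f).hasSum.norm (Filter.Eventually.of_forall fun F => ?_)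
    have h1 := norm_sum_apply_sq_le hm hB hb h0 f F
    have h2 := sum_norm_proj_sq_le hm f F
    refine le_of_sq_le_sq ?_ (by positivity)
    calc _ ≤ _ := h1
      _ ≤ b ^ 2 * 2 ^ m * (2 ^ m * ‖f‖ ^ 2) := by gcongr
      _ = _ := by ring
  let T : Ell2 Λ →ₗ[ℂ] Ell2 Λ :=
    { toFun := fun f => ∑' Z, B Z f
      map_add' := fun f g => by
        simp only [map_add]
        exact (hsum f).tsum_add (hsum g)
      map_smul' := fun c f => by
        simp only [map_smul, RingHom.id_apply]
        exact (hsum f).tsum_const_smul c }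
  exact ⟨T.mkContinuous _ hbound, LinearMap.mkContinuous_norm_le _ (by positivity) _,
    fun f => (hsum f).hasSum⟩

theorem strongSum_eq {ι : Type} {B : ι → Op Λ} {T : Op Λ} (h : ∀ f, HasSum (fun i => B i f) (T f)) :
    strongSum B = T := by
  have hex : ∃ T : Op Λ, ∀ f, HasSum (fun i => B i f) (T f) := ⟨T, h⟩
  rw [strongSum, dif_pos hex]
  exact ContinuousLinearMap.ext fun f => (hex.choose_spec f).unique (h f)

end StrongSums

/-! ### The generator as a bounded operator -/

section Generator

open InnerProductSpace

namespace LindbladTerms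

variable {T : LindbladTerms Λ} {R N : ℝ} {I : ℕ}

/-- `∑_{α ∈ I_Z} L_α ρ L_α^*`. -/
def jumpConj (T : LindbladTerms Λ) (Z : Finset Λ) (ρ : Op Λ) : Op Λ :=
  ∑ i, T.jump Z i * ρ * (T.jump Z i).adjoint

theorem adjoint_jumpSq (T : LindbladTerms Λ) (Z : Finset Λ) :
    (T.jumpSq Z).adjoint = T.jumpSq Z := by
  simp only [jumpSq, map_sum, ContinuousLinearMap.mul_def, ContinuousLinearMap.adjoint_comp,
    ContinuousLinearMap.adjoint_adjoint]

theorem inner_jumpSq (T : LindbladTerms Λ) (Z : Finset Λ) (f : Ell2 Λ) :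
    ⟪f, T.jumpSq Z f⟫_ℂ = ((∑ i, ‖T.jump Z i f‖ ^ 2 : ℝ) : ℂ) := by
  rw [jumpSq, sum_apply, inner_sum, Complex.ofReal_sum]
  refine Finset.sum_congr rfl fun i _ => ?_
  rw [mul_apply_eq_comp, ContinuousLinearMap.adjoint_inner_right, inner_self_eq_norm_sq_to_K]
  simp

namespace IsLocal

variable (hT : T.IsLocal R I N)
include hT

theorem bound_nonneg : 0 ≤ N := (norm_nonneg _).trans (hT.norm_ham_le ∅)

theorem ham_actsIn (Z : Finset Λ) : ActsIn (T.ham Z) Z :=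
  actsIn_of_opSupport_subset (hT.ham_support Z)

theorem jump_actsIn (Z : Finset Λ) (i) : ActsIn (T.jump Z i) Z :=
  actsIn_of_opSupport_subset (hT.jump_support Z i)

theorem jumpSq_actsIn (Z : Finset Λ) : ActsIn (T.jumpSq Z) Z :=
  ActsIn.sum _ fun i _ => (hT.jump_actsIn Z i).adjoint.mul (hT.jump_actsIn Z i)

theorem jumpConj_actsIn (Z : Finset Λ) (ρ : Op Λ) : ActsIn (T.jumpConj Z ρ) Z :=
  ActsIn.sum _ fun i _ => (hT.jump_actsIn Z i).mul_mul (hT.jump_actsIn Z i).adjoint ρ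

theorem jumpSq_eq_zero {Z : Finset Λ} (h : ¬ DiamLE Z R) : T.jumpSq Z = 0 :=
  Finset.sum_eq_zero fun i _ => by rw [hT.jump_eq_zero Z h i, mul_zero]

theorem jumpConj_eq_zero {Z : Finset Λ} (h : ¬ DiamLE Z R) (ρ : Op Λ) : T.jumpConj Z ρ = 0 :=
  Finset.sum_eq_zero fun i _ => by rw [hT.jump_eq_zero Z h i, zero_mul, zero_mul]

theorem norm_sum_jump_le {Z : Finset Λ} {c : ℝ} (hc : 0 ≤ c) {A : Fin (T.numJump Z) → Op Λ}
    (hA : ∀ i, ‖A i‖ ≤ c) : ‖∑ i, A i‖ ≤ I * c := by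
  refine (norm_sum_le _ _).trans ((Finset.sum_le_sum fun i _ => hA i).trans ?_)
  rw [Finset.sum_const, nsmul_eq_mul, Finset.card_univ, Fintype.card_fin]
  gcongr
  exact hT.numJump_le Z

theorem norm_adjoint_jump_le (Z : Finset Λ) (i) : ‖(T.jump Z i).adjoint‖ ≤ N := by
  rw [LinearIsometryEquiv.norm_map]
  exact hT.norm_jump_le Z i

theorem norm_jumpSq_le (Z : Finset Λ) : ‖T.jumpSq Z‖ ≤ I * N ^ 2 := by
  have hN := hT.bound_nonneg
  refine hT.norm_sum_jump_le (by positivity) fun i => (norm_mul_le _ _).trans ?_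
  rw [sq]
  exact mul_le_mul (hT.norm_adjoint_jump_le Z i) (hT.norm_jump_le Z i) (norm_nonneg _) hN

theorem norm_jumpConj_le (Z : Finset Λ) (ρ : Op Λ) : ‖T.jumpConj Z ρ‖ ≤ I * (N ^ 2 * ‖ρ‖) := by
  have hN := hT.bound_nonneg
  refine hT.norm_sum_jump_le (by positivity) fun i => (norm_mul_le _ _).trans ?_
  calc ‖T.jump Z i * ρ‖ * ‖(T.jump Z i).adjoint‖ ≤ N * ‖ρ‖ * N := by
        gcongr
        · exact (norm_mul_le _ _).trans (by gcongr; exact hT.norm_jump_le Z i)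
        · exact hT.norm_adjoint_jump_le Z i
    _ = _ := by ring

end IsLocal

/-- `H`, `J` and `Φ` are the Hamiltonian, `∑_α L_α^* L_α` and `ρ ↦ ∑_α L_α ρ L_α^*`. -/
structure IsGenerator (T : LindbladTerms Λ) (H J : Op Λ) (Φ : Op Λ →L[ℂ] Op Λ) : Prop where
  ham : ∀ f, HasSum (fun Z => T.ham Z f) (H f)
  jumpSq : ∀ f, HasSum (fun Z => T.jumpSq Z f) (J f)
  jumpConj : ∀ ρ f, HasSum (fun Z => T.jumpConj Z ρ f) (Φ ρ f)
  adjoint_ham : H.adjoint = H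
  adjoint_jumpSq : J.adjoint = J

/-- The adjoint is not strongly continuous, so self-adjointness is passed to the limit through inner
products. -/
theorem adjoint_eq_of_hasSum {ι : Type*} {B : ι → Op Λ} {S : Op Λ}
    (hB : ∀ i, (B i).adjoint = B i) (h : ∀ f, HasSum (fun i => B i f) (S f)) : S.adjoint = S := by
  refine ContinuousLinearMap.ext fun f => ext_inner_left ℂ fun g => ?_
  rw [ContinuousLinearMap.adjoint_inner_right]
  have h1 : HasSum (fun i => ⟪g, B i f⟫_ℂ) ⟪g, S f⟫_ℂ := (h f).mapL (innerSL ℂ g)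
  have h2 : HasSum (fun i => ⟪f, B i g⟫_ℂ) ⟪f, S g⟫_ℂ := (h g).mapL (innerSL ℂ f)
  have h3 := h2.star
  simp only [RCLike.star_def, inner_conj_symm] at h3
  refine h3.unique ?_
  convert h1 using 2 with i
  rw [← ContinuousLinearMap.adjoint_inner_right, hB]

/-- `Φ` is defined separately for each `ρ`; linearity follows from uniqueness of strong limits, and
the bound of `exists_strong_sum` is linear in `‖ρ‖`. -/
theorem IsLocal.exists_isGenerator (hT : T.IsLocal R I N) {m : ℕ}
    (hm : ∀ x : Λ, (ball x R).card ≤ m) : ∃ H J Φ, T.IsGenerator H J Φ := by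
  obtain ⟨H, -, hH⟩ := exists_strong_sum hm hT.ham_actsIn hT.norm_ham_le hT.ham_eq_zero
  obtain ⟨J, -, hJ⟩ := exists_strong_sum hm hT.jumpSq_actsIn hT.norm_jumpSq_le
    fun Z h => hT.jumpSq_eq_zero h
  choose Φ hΦn hΦ using fun ρ => exists_strong_sum hm (fun Z => hT.jumpConj_actsIn Z ρ)
    (fun Z => hT.norm_jumpConj_le Z ρ) fun Z h => hT.jumpConj_eq_zero h ρ
  let Φl : Op Λ →ₗ[ℂ] Op Λ :=
    { toFun := Φ
      map_add' := fun ρ σ => ContinuousLinearMap.ext fun f => by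
        refine (hΦ (ρ + σ) f).unique ?_
        convert (hΦ ρ f).add (hΦ σ f) using 2 with Z
        simp only [LindbladTerms.jumpConj, mul_add, add_mul, Finset.sum_add_distrib, add_apply]
        rfl
      map_smul' := fun c ρ => ContinuousLinearMap.ext fun f => by
        refine (hΦ (c • ρ) f).unique ?_
        convert (hΦ ρ f).const_smul c using 2 with Z
        simp only [LindbladTerms.jumpConj, mul_smul_comm, smul_mul_assoc, ← Finset.smul_sum,
          smul_apply]
        rfl }
  refine ⟨H, J, Φl.mkContinuous (I * N ^ 2 * 2 ^ m) fun ρ => (hΦn ρ).trans_eq (by ring), hH, hJ, hΦ,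
    adjoint_eq_of_hasSum (fun Z => ?_) hH, adjoint_eq_of_hasSum T.adjoint_jumpSq hJ⟩
  exact ContinuousLinearMap.isSelfAdjoint_iff'.1 (hT.ham_selfAdjoint Z)

/-- The generator `-i H - J / 2` of the dissipative part of the evolution. -/
def drift (H J : Op Λ) : Op Λ := (-Complex.I) • H - (1 / 2 : ℂ) • J

/-- The Hamiltonian part is purely imaginary in expectation, so only `J` dissipates. -/
theorem re_inner_drift {H : Op Λ} (hH : H.adjoint = H) (J : Op Λ) (f : Ell2 Λ) :
    2 * (⟪f, drift H J f⟫_ℂ).re = -(⟪f, J f⟫_ℂ).re := by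
  have h1 : (⟪f, H f⟫_ℂ).im = 0 := by
    have h2 : (starRingEnd ℂ) ⟪f, H f⟫_ℂ = ⟪f, H f⟫_ℂ := by
      rw [inner_conj_symm, ← ContinuousLinearMap.adjoint_inner_right, hH]
    exact Complex.conj_eq_iff_im.1 h2
  simp only [drift, sub_apply, smul_apply, inner_sub_right, inner_smul_right, Complex.sub_re,
    Complex.mul_re, Complex.neg_re, Complex.neg_im, Complex.I_re, Complex.I_im, h1]
  norm_num
  ring

/-- `ρ ↦ K ρ + ρ K^* + Φ(ρ)` as a bounded operator. -/
def generator (K : Op Λ) (Φ : Op Λ →L[ℂ] Op Λ) : Op Λ →L[ℂ] Op Λ :=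
  ContinuousLinearMap.mul ℂ (Op Λ) K + (ContinuousLinearMap.mul ℂ (Op Λ)).flip K.adjoint + Φ

theorem generator_apply (K : Op Λ) (Φ : Op Λ →L[ℂ] Op Λ) (ρ : Op Λ) :
    generator K Φ ρ = K * ρ + ρ * K.adjoint + Φ ρ := rfl

namespace IsGenerator

variable {H J : Op Λ} {Φ : Op Λ →L[ℂ] Op Λ} (hG : T.IsGenerator H J Φ)
include hG

theorem adjoint_drift : (drift H J).adjoint = Complex.I • H - (1 / 2 : ℂ) • J := by
  have h : (starRingEnd ℂ) (1 / 2 : ℂ) = 1 / 2 := Complex.conj_eq_iff_im.2 (by norm_num)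
  simp only [drift, map_sub, map_smulₛₗ, hG.adjoint_ham, hG.adjoint_jumpSq, h, map_neg,
    Complex.conj_I, neg_neg]

theorem lindbladian_eq (ρ : Op Λ) : T.lindbladian ρ = generator (drift H J) Φ ρ := by
  have h1 : T.hamiltonian = H := strongSum_eq hG.ham
  have h2 : strongSum (fun Z => T.dissipator Z ρ) = Φ ρ - (1 / 2 : ℂ) • (J * ρ + ρ * J) := by
    refine strongSum_eq fun f => ?_
    have h3 := (hG.jumpSq (ρ f)).add ((hG.jumpSq f).mapL ρ)
    convert (hG.jumpConj ρ f).sub (h3.const_smul (1 / 2 : ℂ)) using 2 with Z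
    · simp only [dissipator, LindbladTerms.jumpConj, LindbladTerms.jumpSq, Finset.sum_sub_distrib,
        ← Finset.smul_sum, Finset.sum_add_distrib, ← Finset.sum_mul, ← Finset.mul_sum]
      rfl
    · rfl
  rw [lindbladian, h1, h2, generator_apply, hG.adjoint_drift, drift]
  simp only [sub_mul, mul_sub, smul_mul_assoc, mul_smul_comm, smul_sub, smul_add, neg_smul, neg_mul]
  abel

theorem hasSum_norm_jump_sq (f : Ell2 Λ) :
    HasSum (fun p : Σ Z, Fin (T.numJump Z) => ‖T.jump p.1 p.2 f‖ ^ 2) (⟪f, J f⟫_ℂ).re := by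
  have h1 : HasSum (fun Z => ∑ i, ‖T.jump Z i f‖ ^ 2) (⟪f, J f⟫_ℂ).re := by
    have h2 : HasSum (fun Z => ⟪f, T.jumpSq Z f⟫_ℂ) ⟪f, J f⟫_ℂ := (hG.jumpSq f).mapL (innerSL ℂ f)
    simpa only [inner_jumpSq, Complex.ofReal_re] using Complex.hasSum_re h2
  have h3 : Summable fun p : Σ Z, Fin (T.numJump Z) => ‖T.jump p.1 p.2 f‖ ^ 2 := by
    rw [summable_sigma_of_nonneg fun _ => by positivity]
    refine ⟨fun Z => Summable.of_finite, ?_⟩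
    simpa only [tsum_fintype] using h1.summable
  have h4 := h3.hasSum.sigma fun Z => hasSum_fintype _
  rw [h1.unique h4]
  exact h3.hasSum

/-- The norms `‖L_α f‖²` are summable with sum `⟨f, J f⟩`, which upgrades the strong convergence
defining `Φ` to norm convergence: a pure state jumps to a mixture. -/
theorem hasSum_rankOne_jump (f : Ell2 Λ) :
    HasSum (fun p : Σ Z, Fin (T.numJump Z) => rankOne ℂ (T.jump p.1 p.2 f) (T.jump p.1 p.2 f))
      (Φ (rankOne ℂ f f)) := by
  have h1 : Summable fun p : Σ Z, Fin (T.numJump Z) =>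
      rankOne ℂ (T.jump p.1 p.2 f) (T.jump p.1 p.2 f) := by
    refine Summable.of_norm ?_
    simpa only [norm_rankOne, ← sq] using (hG.hasSum_norm_jump_sq f).summable
  have h2 : Φ (rankOne ℂ f f) = ∑' p : Σ Z, Fin (T.numJump Z),
      rankOne ℂ (T.jump p.1 p.2 f) (T.jump p.1 p.2 f) := by
    ext1 g
    refine (hG.jumpConj _ g).unique ?_
    have h3 := (h1.hasSum.mapL (ContinuousLinearMap.apply ℂ (Ell2 Λ) g)).sigma
      fun Z => hasSum_fintype _
    convert h3 using 2 with Z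
    · rw [LindbladTerms.jumpConj, sum_apply]
      refine Finset.sum_congr rfl fun i _ => ?_
      rw [ContinuousLinearMap.mul_def, ContinuousLinearMap.mul_def, comp_rankOne, rankOne_comp,
        ContinuousLinearMap.adjoint_adjoint]
      rfl
    · rfl
  rw [h2]
  exact h1.hasSum

end IsGenerator

end LindbladTerms

end Generator

/-! ### Mixtures of pure states and the boundedness of the evolution -/

section Mixture

open InnerProductSpace Filter Topology LindbladTerms

theorem exists_selfAdjoint_mul_self {E : Type*} [NormedAddCommGroup E] [InnerProductSpace ℂ E]
    [CompleteSpace E] {ρ : E →L[ℂ] E} (h : ρ.IsPositive) :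
    ∃ r : E →L[ℂ] E, r.adjoint = r ∧ r * r = ρ :=
  have h0 : 0 ≤ ρ := (ContinuousLinearMap.nonneg_iff_isPositive ρ).2 h
  ⟨CFC.sqrt ρ, ContinuousLinearMap.isSelfAdjoint_iff'.1
    (IsSelfAdjoint.of_nonneg (CFC.sqrt_nonneg ρ)), CFC.sqrt_mul_sqrt_self ρ h0⟩

/-- `X` is a norm-convergent series `∑ |φᵢ⟩⟨φᵢ|` with `∑ ‖φᵢ‖² ≤ c`. -/
def IsMixture (c : ℝ) (X : Op Λ) : Prop :=
  ∃ (ι : Type) (φ : ι → Ell2 Λ) (s : ℝ), s ≤ c ∧ HasSum (fun i => ‖φ i‖ ^ 2) s ∧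
    HasSum (fun i => rankOne ℂ (φ i) (φ i)) X

/-- The rank-one term of `φ` has operator norm `‖φ‖²`, so the trace bound passes to the operator
norm. -/
theorem IsMixture.norm_le {c : ℝ} {X : Op Λ} (h : IsMixture c X) : ‖X‖ ≤ c := by
  obtain ⟨ι, φ, s, hs, h1, h2⟩ := h
  refine le_trans (h2.norm_le_of_bounded h1 fun i => ?_) hs
  rw [norm_rankOne, sq]

/-- With `r = √ρ`, insert the resolution of the identity into `ρ = r r`: the vectors are `r δ_x`,
and their squared norms are the diagonal entries of `ρ`. -/
theorem IsState.isMixture {ρ : Op Λ} (hρ : IsState ρ) : IsMixture 1 ρ := by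
  obtain ⟨r, hra, hrr⟩ := exists_selfAdjoint_mul_self hρ.nonneg
  have hin : ∀ f g, ⟪r f, r g⟫_ℂ = ⟪f, ρ g⟫_ℂ := by
    intro f g
    rw [← hrr, mul_apply_eq_comp, ← ContinuousLinearMap.adjoint_inner_right, hra]
  have hn : HasSum (fun x => ‖r (δ x)‖ ^ 2) 1 := by
    have h1 := Complex.hasSum_re hρ.trace_eq_one
    convert h1 using 2 with x
    · rw [elt, ← hin, inner_self_eq_norm_sq_to_K, ← RCLike.ofReal_pow]
      rfl
    · rfl
  have hs : Summable fun x => rankOne ℂ (r (δ x)) (r (δ x)) := by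
    refine Summable.of_norm ?_
    simpa only [norm_rankOne, ← sq] using hn.summable
  refine ⟨Λ, fun x => r (δ x), 1, le_rfl, hn, ?_⟩
  convert hs.hasSum
  refine ContinuousLinearMap.ext fun f => ext_inner_left ℂ fun g => ?_
  have h1 := (hs.hasSum.mapL (ContinuousLinearMap.apply ℂ (Ell2 Λ) f)).mapL (innerSL ℂ g)
  refine HasSum.unique ?_ h1
  have h2 := lp.hasSum_inner (𝕜 := ℂ) (r g) (r f)
  rw [hin] at h2
  convert h2 using 2 with x
  simp only [ContinuousLinearMap.apply_apply, rankOne_apply, innerSL_apply_apply, inner_smul_right]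
  have h3 : ∀ a b, ⟪r a, b⟫_ℂ = ⟪a, r b⟫_ℂ := fun a b => by
    rw [← ContinuousLinearMap.adjoint_inner_right, hra]
  rw [h3, inner_delta_left, ← h3, inner_delta_right]
  simp

theorem hasSum_option_of_hasSum {β α : Type*} [AddCommGroup α] [TopologicalSpace α]
    [IsTopologicalAddGroup α] {f : Option β → α} {a : α} (h : HasSum (fun b => f (some b)) a) :
    HasSum f (f none + a) := by
  have h1 : HasSum (fun o : Option β => if o = none then f none else 0) (f none) := by
    simpa using hasSum_ite_eq (none : Option β) (f none)
  have h2 : HasSum (fun o : Option β => if o = none then 0 else f o) a := by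
    refine ((Option.some_injective β).hasSum_iff fun o ho => ?_).1 (by simpa [Function.comp_def] using h)
    have : o = none := by
      rcases o with _ | b
      · rfl
      · exact (ho ⟨b, rfl⟩).elim
    simp [this]
  convert h1.add h2 using 2 with o
  split_ifs with ho
  · simp [ho]
  · simp

/-- The Euler step `ρ ↦ (1 + sK) ρ (1 + sK)^* + s Φ(ρ)`, a completely positive map. -/
def eulerStep (K : Op Λ) (Φ : Op Λ →L[ℂ] Op Λ) (s : ℝ) : Op Λ →L[ℂ] Op Λ :=
  1 + s • generator K Φ
    + (s ^ 2) • (ContinuousLinearMap.mul ℂ (Op Λ) K).comp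
        ((ContinuousLinearMap.mul ℂ (Op Λ)).flip K.adjoint)

/-- The second-order term `s² K X K^*` completes the square, which makes the step positive for `s ≥
0`. -/
theorem eulerStep_apply (K : Op Λ) (Φ : Op Λ →L[ℂ] Op Λ) (s : ℝ) (X : Op Λ) :
    eulerStep K Φ s X
      = (1 + (s : ℂ) • K) * X * (1 + (s : ℂ) • K).adjoint + (s : ℂ) • Φ X := by
  have h1 : (1 + (s : ℂ) • K).adjoint = 1 + (s : ℂ) • K.adjoint := by
    rw [map_add, map_smulₛₗ, Complex.conj_ofReal]
    congr 1
    exact ContinuousLinearMap.adjoint_id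
  have h2 : eulerStep K Φ s X
      = X + (s : ℂ) • (K * X + X * K.adjoint + Φ X) + ((s : ℂ) ^ 2) • (K * (X * K.adjoint)) := by
    rw [← Complex.ofReal_pow]
    rfl
  rw [h1, h2]
  simp only [add_mul, mul_add, one_mul, mul_one, smul_mul_assoc, mul_smul_comm, smul_smul,
    smul_add, mul_assoc, sq]
  abel

namespace LindbladTerms.IsGenerator

variable {T : LindbladTerms Λ} {H J : Op Λ} {Φ : Op Λ →L[ℂ] Op Λ} (hG : T.IsGenerator H J Φ)
include hG

/-- The weight lost by the drift equals the weight gained by the jumps at first order in `s`; only a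
term of order `s²` remains. -/
theorem norm_sq_step (f : Ell2 Λ) (s : ℝ) :
    ‖(1 + (s : ℂ) • drift H J) f‖ ^ 2 + s * (⟪f, J f⟫_ℂ).re
      = ‖f‖ ^ 2 + s ^ 2 * ‖drift H J f‖ ^ 2 := by
  have h1 : (1 + (s : ℂ) • drift H J) f = f + (s : ℂ) • drift H J f := rfl
  have h2 := re_inner_drift hG.adjoint_ham J f
  rw [h1, norm_add_sq (𝕜 := ℂ), inner_smul_right, norm_smul, mul_pow]
  simp only [RCLike.re_eq_complex_re, Complex.re_ofReal_mul, Complex.norm_real, Real.norm_eq_abs,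
    sq_abs]
  linear_combination s * h2

/-- Each `φᵢ` branches into the no-jump vector `(1 + sK) φᵢ` (index `none`) and the vectors `√s L_α
φᵢ` after a jump; `norm_sq_step` accounts for the total weight. -/
theorem isMixture_eulerStep {c s : ℝ} (hs : 0 ≤ s) {X : Op Λ} (hX : IsMixture c X) :
    IsMixture ((1 + s ^ 2 * ‖drift H J‖ ^ 2) * c) (eulerStep (drift H J) Φ s X) := by
  obtain ⟨ι, φ, S, hSc, hn, hX⟩ := hX
  set K := drift H J with hK
  let P := Σ Z, Fin (T.numJump Z)
  let ψ : ι × Option P → Ell2 Λ := fun q =>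
    match q.2 with
    | none => (1 + (s : ℂ) • K) (φ q.1)
    | some p => ((Real.sqrt s : ℝ) : ℂ) • T.jump p.1 p.2 (φ q.1)
  have hfn : ∀ i, HasSum (fun o => ‖ψ (i, o)‖ ^ 2) (‖φ i‖ ^ 2 + s ^ 2 * ‖K (φ i)‖ ^ 2) := by
    intro i
    rw [← hG.norm_sq_step]
    refine hasSum_option_of_hasSum (f := fun o => ‖ψ (i, o)‖ ^ 2) ?_
    have h1 : (fun p => ‖ψ (i, some p)‖ ^ 2) = fun p => s * ‖T.jump p.1 p.2 (φ i)‖ ^ 2 := by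
      funext p
      simp only [ψ, norm_smul, mul_pow, Complex.norm_real, Real.norm_eq_abs, sq_abs,
        Real.sq_sqrt hs]
    rw [h1]
    exact (hG.hasSum_norm_jump_sq (φ i)).mul_left s
  have hfo : ∀ i, HasSum (fun o => rankOne ℂ (ψ (i, o)) (ψ (i, o)))
      (eulerStep K Φ s (rankOne ℂ (φ i) (φ i))) := by
    intro i
    have h1 : (1 + (s : ℂ) • K) * rankOne ℂ (φ i) (φ i) * (1 + (s : ℂ) • K).adjoint
        = rankOne ℂ (ψ (i, none)) (ψ (i, none)) := by
      rw [ContinuousLinearMap.mul_def, ContinuousLinearMap.mul_def, comp_rankOne, rankOne_comp,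
        ContinuousLinearMap.adjoint_adjoint]
    rw [eulerStep_apply, h1]
    refine hasSum_option_of_hasSum (f := fun o => rankOne ℂ (ψ (i, o)) (ψ (i, o))) ?_
    have h2 : (fun p => rankOne ℂ (ψ (i, some p)) (ψ (i, some p)))
        = fun p => (s : ℂ) • rankOne ℂ (T.jump p.1 p.2 (φ i)) (T.jump p.1 p.2 (φ i)) := by
      funext p
      simp only [ψ, map_smulₛₗ, smul_apply, Complex.conj_ofReal, smul_smul, RingHom.id_apply,
        ← Complex.ofReal_mul, Real.mul_self_sqrt hs]
    rw [h2]
    exact (hG.hasSum_rankOne_jump (φ i)).const_smul (s : ℂ)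
  have hle : ∀ i, ‖φ i‖ ^ 2 + s ^ 2 * ‖K (φ i)‖ ^ 2 ≤ (1 + s ^ 2 * ‖K‖ ^ 2) * ‖φ i‖ ^ 2 := by
    intro i
    have h1 : ‖K (φ i)‖ ^ 2 ≤ (‖K‖ * ‖φ i‖) ^ 2 :=
      pow_le_pow_left₀ (norm_nonneg _) (K.le_opNorm _) 2
    have h2 := mul_le_mul_of_nonneg_left h1 (sq_nonneg s)
    linarith [mul_pow ‖K‖ ‖φ i‖ 2 ▸ h2]
  have hsum : Summable fun i => ‖φ i‖ ^ 2 + s ^ 2 * ‖K (φ i)‖ ^ 2 :=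
    Summable.of_nonneg_of_le (fun i => by positivity) hle (hn.summable.mul_left _)
  have hψ : Summable fun q => ‖ψ q‖ ^ 2 := by
    rw [summable_prod_of_nonneg fun q => by positivity]
    refine ⟨fun i => (hfn i).summable, ?_⟩
    simpa only [(hfn _).tsum_eq] using hsum
  have hψo : Summable fun q => rankOne ℂ (ψ q) (ψ q) := by
    refine Summable.of_norm ?_
    simpa only [norm_rankOne, ← sq] using hψ
  refine ⟨ι × Option P, ψ, _, ?_, hψ.hasSum, ?_⟩
  · have h1 := hψ.hasSum.prod_fiberwise hfn
    refine (hasSum_le hle h1 (hn.mul_left _)).trans ?_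
    exact mul_le_mul_of_nonneg_left hSc (by positivity)
  · have h1 := hψo.hasSum.prod_fiberwise hfo
    rw [(hX.mapL (eulerStep K Φ s)).unique h1]
    exact hψo.hasSum

theorem isMixture_eulerStep_pow {c s : ℝ} (hs : 0 ≤ s) {X : Op Λ} (hX : IsMixture c X) (k : ℕ) :
    IsMixture ((1 + s ^ 2 * ‖drift H J‖ ^ 2) ^ k * c) ((eulerStep (drift H J) Φ s ^ k) X) := by
  induction k with
  | zero => simpa using hX
  | succ k ih =>
    have := hG.isMixture_eulerStep hs ih
    rw [← mul_assoc, ← pow_succ'] at this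
    rwa [pow_succ' (eulerStep _ _ _), mul_apply_eq_comp]

end LindbladTerms.IsGenerator

end Mixture

/-! ### The Euler method in a Banach algebra -/

section Euler

open Filter Topology

variable {𝔸 : Type*} [NormedRing 𝔸]

/-- `‖1‖ ≤ 1` is assumed rather than `‖1‖ = 1` because the operator algebra is trivial when `Λ` is
empty. -/
theorem norm_pow_le_of_one_le {a : 𝔸} {C : ℝ} (h1 : ‖(1 : 𝔸)‖ ≤ 1) (ha : ‖a‖ ≤ C) (k : ℕ) :
    ‖a ^ k‖ ≤ C ^ k := by
  induction k with
  | zero => simpa using h1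
  | succ k ih =>
    rw [pow_succ, pow_succ]
    exact (norm_mul_le _ _).trans
      (mul_le_mul ih ha (norm_nonneg _) (pow_nonneg ((norm_nonneg _).trans ha) _))

theorem norm_pow_sub_pow_le {a b : 𝔸} {C : ℝ} (h1 : ‖(1 : 𝔸)‖ ≤ 1) (hC : 1 ≤ C) (ha : ‖a‖ ≤ C)
    (hb : ‖b‖ ≤ C) (k : ℕ) : ‖a ^ k - b ^ k‖ ≤ k * ‖a - b‖ * C ^ k := by
  induction k with
  | zero => simp
  | succ k ih =>
    have hC0 : 0 ≤ C := zero_le_one.trans hC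
    have h2 : a ^ (k + 1) - b ^ (k + 1) = a * (a ^ k - b ^ k) + (a - b) * b ^ k := by
      rw [pow_succ', pow_succ']; noncomm_ring
    have h3 : C ^ k ≤ C ^ (k + 1) := pow_le_pow_right₀ hC (Nat.le_succ k)
    have h4 : ‖a - b‖ * C ^ k ≤ ‖a - b‖ * C ^ (k + 1) :=
      mul_le_mul_of_nonneg_left h3 (norm_nonneg _)
    calc ‖a ^ (k + 1) - b ^ (k + 1)‖
        ≤ ‖a‖ * ‖a ^ k - b ^ k‖ + ‖a - b‖ * ‖b ^ k‖ := by
          rw [h2]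
          exact (norm_add_le _ _).trans (add_le_add (norm_mul_le _ _) (norm_mul_le _ _))
      _ ≤ C * (k * ‖a - b‖ * C ^ k) + ‖a - b‖ * C ^ k := by
          gcongr
          exact norm_pow_le_of_one_le h1 hb k
      _ ≤ _ := by
          have h5 : C * (k * ‖a - b‖ * C ^ k) = k * ‖a - b‖ * C ^ (k + 1) := by ring
          push_cast
          linarith

variable [NormedAlgebra ℝ 𝔸] [CompleteSpace 𝔸]

theorem norm_exp_le_exp_norm (h1 : ‖(1 : 𝔸)‖ ≤ 1) (x : 𝔸) :
    ‖NormedSpace.exp x‖ ≤ Real.exp ‖x‖ := by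
  have h2 := NormedSpace.exp_series_hasSum_exp' (𝕂 := ℝ) x
  have h3 := NormedSpace.exp_series_hasSum_exp' (𝕂 := ℝ) ‖x‖
  rw [← Real.exp_eq_exp_ℝ] at h3
  refine h2.norm_le_of_bounded h3 fun k => ?_
  rw [norm_smul, Real.norm_eq_abs, abs_of_nonneg (by positivity), smul_eq_mul]
  exact mul_le_mul_of_nonneg_left (norm_pow_le_of_one_le h1 le_rfl k) (by positivity)

/-- One step differs from `exp(sL)` by `o(s)`, as both have derivative `L` at `s = 0`. The `k + 1`
steps of size `t / (k + 1)` accumulate an error `t · o(1)`, since all factors are at most `C` and `C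
^ (k + 1)` does not depend on `k`. -/
theorem tendsto_euler_pow (h1 : ‖(1 : 𝔸)‖ ≤ 1) (L M : 𝔸) {t : ℝ} (ht : 0 < t) :
    Tendsto (fun k : ℕ => (1 + (t / (k + 1 : ℕ)) • L + (t / (k + 1 : ℕ)) ^ 2 • M) ^ (k + 1)) atTop
      (𝓝 (NormedSpace.exp (t • L))) := by
  set s : ℕ → ℝ := fun k => t / (k + 1 : ℕ) with hs
  have hk : ∀ k : ℕ, (0 : ℝ) < (k + 1 : ℕ) := fun k => by positivity
  have hs0 : ∀ k, 0 < s k := fun k => div_pos ht (hk k)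
  have hst : ∀ k, s k ≤ t := fun k => div_le_self ht.le (by push_cast; linarith [k.cast_nonneg (α := ℝ)])
  have hsk : ∀ k, (k + 1 : ℕ) * s k = t := fun k => mul_div_cancel₀ _ (hk k).ne'
  set g : ℝ → 𝔸 := fun s => (1 + s • L + s ^ 2 • M) - NormedSpace.exp (s • L) with hg
  have hgd : HasDerivAt g 0 0 := by
    have e1 := hasDerivAt_exp_smul_const (𝕂 := ℝ) L (0 : ℝ)
    have e2 : HasDerivAt (fun s : ℝ => 1 + s • L + s ^ 2 • M) L 0 := by
      have := (((hasDerivAt_id (0 : ℝ)).smul_const L).const_add 1).add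
        ((hasDerivAt_pow 2 (0 : ℝ)).smul_const M)
      exact this.congr_deriv (by simp)
    exact (e2.sub e1).congr_deriv (by simp)
  have hstend : Tendsto s atTop (𝓝[≠] 0) := by
    refine tendsto_nhdsWithin_iff.2 ⟨?_, Eventually.of_forall fun k => (hs0 k).ne'⟩
    exact (tendsto_const_div_atTop_nhds_zero_nat t).comp (tendsto_add_atTop_nat 1)
  have hlim := hgd.tendsto_slope_zero.comp hstend
  have hg0 : g 0 = 0 := by simp [hg]
  have hlim2 : Tendsto (fun k => t * ‖(s k)⁻¹ • g (s k)‖ * Real.exp (t * (‖L‖ + t * ‖M‖))) atTop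
      (𝓝 0) := by
    have := (hlim.norm.const_mul t).mul_const (Real.exp (t * (‖L‖ + t * ‖M‖)))
    simpa [hg0, Function.comp_def] using this
  rw [tendsto_iff_norm_sub_tendsto_zero]
  refine squeeze_zero (fun _ => norm_nonneg _) (fun k => ?_) hlim2
  have hexp : NormedSpace.exp (t • L) = NormedSpace.exp (s k • L) ^ (k + 1) := by
    let _ : NormedAlgebra ℚ 𝔸 := NormedAlgebra.restrictScalars ℚ ℝ 𝔸
    rw [← NormedSpace.exp_nsmul, ← Nat.cast_smul_eq_nsmul ℝ, smul_smul, hsk]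
  set C := Real.exp (s k * (‖L‖ + t * ‖M‖)) with hC
  have hC1 : 1 ≤ C := Real.one_le_exp (by have := (hs0 k).le; positivity)
  have ha : ‖1 + s k • L + s k ^ 2 • M‖ ≤ C := by
    have e1 : ‖s k • L‖ = s k * ‖L‖ := by
      rw [norm_smul, Real.norm_eq_abs, abs_of_pos (hs0 k)]
    have e2 : ‖s k ^ 2 • M‖ ≤ s k * (t * ‖M‖) := by
      rw [norm_smul, Real.norm_eq_abs, abs_of_nonneg (by positivity), sq, mul_assoc]
      have := hst k
      have := (hs0 k).le
      gcongr
    have e3 := norm_add₃_le (a := (1 : 𝔸)) (b := s k • L) (c := s k ^ 2 • M)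
    have e4 := Real.add_one_le_exp (s k * (‖L‖ + t * ‖M‖))
    linarith
  have hb : ‖NormedSpace.exp (s k • L)‖ ≤ C := by
    refine (norm_exp_le_exp_norm h1 _).trans (Real.exp_le_exp.2 ?_)
    rw [norm_smul, Real.norm_eq_abs, abs_of_pos (hs0 k)]
    have := (hs0 k).le
    gcongr
    exact le_add_of_nonneg_right (by positivity)
  have h2 := norm_pow_sub_pow_le h1 hC1 ha hb (k + 1)
  rw [hexp]
  refine h2.trans_eq ?_
  have h3 : C ^ (k + 1) = Real.exp (t * (‖L‖ + t * ‖M‖)) := by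
    rw [hC, ← Real.exp_nat_mul, ← mul_assoc, hsk]
  rw [h3, norm_smul, norm_inv, Real.norm_eq_abs, abs_of_pos (hs0 k), ← hsk k]
  have := (hs0 k).ne'
  field_simp
  rfl

end Euler

/-! ### Time evolution and Abel averages -/

section Evolution

open Filter Topology MeasureTheory

section Abstract

variable {E : Type*} [NormedAddCommGroup E] [NormedSpace ℂ E] [CompleteSpace E]

/-- The uniformly continuous semigroup `e^{tL}` generated by a bounded operator. -/
def expSemigroup (L : E →L[ℂ] E) (t : ℝ) : E →L[ℂ] E := NormedSpace.exp (t • L)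

omit [CompleteSpace E] in
theorem expSemigroup_zero (L : E →L[ℂ] E) (x : E) : expSemigroup L 0 x = x := by
  rw [expSemigroup, zero_smul, NormedSpace.exp_zero, one_apply_eq_self]

theorem hasSum_expSemigroup (L : E →L[ℂ] E) (t : ℝ) (x : E) :
    HasSum (fun k : ℕ => ((t ^ k / (k.factorial : ℝ) : ℝ) : ℂ) • (L ^ k) x)
      (expSemigroup L t x) := by
  have h2 := (NormedSpace.exp_series_hasSum_exp' (𝕂 := ℝ) (t • L)).mapL
    ((ContinuousLinearMap.apply ℂ E x).restrictScalars ℝ)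
  have h3 : (fun k : ℕ => ((t ^ k / (k.factorial : ℝ) : ℝ) : ℂ) • (L ^ k) x)
      = fun k : ℕ => ((ContinuousLinearMap.apply ℂ E x).restrictScalars ℝ)
          (((k.factorial : ℝ))⁻¹ • (t • L) ^ k) := by
    funext k
    rw [smul_pow, smul_smul, inv_mul_eq_div, Complex.coe_smul]
    rfl
  rw [h3]
  exact h2

theorem hasDerivAt_expSemigroup (L : E →L[ℂ] E) (t : ℝ) (x : E) :
    HasDerivAt (fun t => expSemigroup L t x) (L (expSemigroup L t x)) t :=
  ((ContinuousLinearMap.apply ℂ E x).restrictScalars ℝ).hasFDerivAt.comp_hasDerivAt t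
      (hasDerivAt_exp_smul_const' (𝕂 := ℝ) L t)

theorem tendsto_euler_expSemigroup (L M : E →L[ℂ] E) {t : ℝ} (ht : 0 < t) (x : E) :
    Tendsto (fun k : ℕ => ‖((1 + (t / (k + 1 : ℕ)) • L + (t / (k + 1 : ℕ)) ^ 2 • M) ^ (k + 1)) x‖)
      atTop (𝓝 ‖expSemigroup L t x‖) :=
  (((ContinuousLinearMap.apply ℂ E x).continuous.tendsto _).comp
    (tendsto_euler_pow ContinuousLinearMap.norm_id_le L M ht)).norm

end Abstract

namespace LindbladTerms.IsGenerator

variable {T : LindbladTerms Λ} {H J : Op Λ} {Φ : Op Λ →L[ℂ] Op Λ} (hG : T.IsGenerator H J Φ)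
include hG

theorem evolution_eq (t : ℝ) (ρ : Op Λ) :
    T.evolution t ρ = expSemigroup (generator (drift H J) Φ) t ρ := by
  set L := generator (drift H J) Φ with hL
  have h1 : ∀ k, T.lindbladian^[k] ρ = (L ^ k) ρ := by
    intro k
    induction k with
    | zero => rfl
    | succ k ih => rw [Function.iterate_succ_apply', ih, hG.lindbladian_eq, pow_succ',
        mul_apply_eq_comp]
  simp only [evolution, h1]
  exact (hasSum_expSemigroup L t ρ).tsum_eq

/-- The evolved state is a limit of Euler iterates, which are mixtures of weight at most `exp(t²
‖K‖² / (k + 1))`; this tends to `1`. -/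
theorem norm_evolution_le {t : ℝ} (ht : 0 ≤ t) {ρ : Op Λ} (hρ : IsState ρ) :
    ‖T.evolution t ρ‖ ≤ 1 := by
  rw [hG.evolution_eq]
  set K := drift H J with hK
  rcases ht.eq_or_lt with rfl | ht
  · rw [expSemigroup_zero]
    exact hρ.isMixture.norm_le
  have h2 := tendsto_euler_expSemigroup (generator K Φ) ((ContinuousLinearMap.mul ℂ (Op Λ) K).comp
    ((ContinuousLinearMap.mul ℂ (Op Λ)).flip K.adjoint)) ht ρ
  have h3 : Tendsto (fun k : ℕ => Real.exp (t ^ 2 * ‖K‖ ^ 2 / (k + 1 : ℕ))) atTop (𝓝 1) := by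
    have := (tendsto_const_div_atTop_nhds_zero_nat (t ^ 2 * ‖K‖ ^ 2)).comp (tendsto_add_atTop_nat 1)
    have h4 := (Real.continuous_exp.tendsto 0).comp this
    rwa [Real.exp_zero] at h4
  refine le_of_tendsto_of_tendsto' h2 h3 fun k => ?_
  have hk : (0 : ℝ) < (k + 1 : ℕ) := by positivity
  have h4 := (hG.isMixture_eulerStep_pow (div_nonneg ht.le hk.le) hρ.isMixture (k + 1)).norm_le
  refine h4.trans ?_
  rw [mul_one, add_comm]
  refine (pow_le_pow_left₀ (by positivity) (Real.add_one_le_exp _) _).trans_eq ?_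
  rw [← Real.exp_nat_mul]
  congr 1
  field_simp
  rfl

theorem hasDerivAt_abelIntegrand (ε : ℝ) (ρ : Op Λ) (t : ℝ) :
    HasDerivAt (T.abelIntegrand ε ρ) ((generator (drift H J) Φ
      - (ε : ℂ) • (1 : Op Λ →L[ℂ] Op Λ)) (T.abelIntegrand ε ρ t)) t := by
  set L := generator (drift H J) Φ with hL
  have h0 : T.abelIntegrand ε ρ
      = fun t => Real.exp (-(t * ε)) • expSemigroup L t ρ := by
    funext t
    rw [abelIntegrand, hG.evolution_eq, Complex.coe_smul, hL]
    rfl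
  have h1 := hasDerivAt_expSemigroup L t ρ
  have h2 : HasDerivAt (fun t : ℝ => Real.exp (-(t * ε))) (Real.exp (-(t * ε)) * -ε) t := by
    simpa using (((hasDerivAt_id t).mul_const ε).neg).exp
  rw [h0]
  refine (h2.smul h1).congr_deriv ?_
  have h3 : L (Real.exp (-(t * ε)) • expSemigroup L t ρ)
      = Real.exp (-(t * ε)) • L (expSemigroup L t ρ) := L.map_smul_of_tower _ _
  simp only [sub_apply, smul_apply, one_apply_eq_self, h3, Complex.coe_smul]
  rw [mul_comm (Real.exp _) (-ε), mul_smul, neg_smul]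
  abel

theorem norm_abelIntegrand_le (ε : ℝ) {t : ℝ} (ht : 0 ≤ t) {ρ : Op Λ} (hρ : IsState ρ) :
    ‖T.abelIntegrand ε ρ t‖ ≤ Real.exp (-ε * t) := by
  rw [abelIntegrand, norm_smul, Complex.norm_real, Real.norm_eq_abs, abs_of_pos (Real.exp_pos _),
    neg_mul, mul_comm ε]
  exact mul_le_of_le_one_right (Real.exp_pos _).le (hG.norm_evolution_le ht hρ)

theorem integrableOn_abelIntegrand {ε : ℝ} (hε : 0 < ε) {ρ : Op Λ} (hρ : IsState ρ) :
    IntegrableOn (T.abelIntegrand ε ρ) (Set.Ioi 0) := by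
  have hc : Continuous (T.abelIntegrand ε ρ) :=
    continuous_iff_continuousAt.2 fun t => (hG.hasDerivAt_abelIntegrand ε ρ t).continuousAt
  refine Integrable.mono' (exp_neg_integrableOn_Ioi 0 hε) hc.aestronglyMeasurable ?_
  filter_upwards [ae_restrict_mem measurableSet_Ioi] with t ht
  exact hG.norm_abelIntegrand_le ε (le_of_lt ht) hρ

theorem norm_abelAverage_le {ε : ℝ} (hε : 0 < ε) {ρ : Op Λ} (hρ : IsState ρ) :
    ‖T.abelAverage ε ρ‖ ≤ 1 := by
  have h1 : ‖∫ t in Set.Ioi (0 : ℝ), T.abelIntegrand ε ρ t‖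
      ≤ ∫ t in Set.Ioi (0 : ℝ), Real.exp (-ε * t) := by
    refine norm_integral_le_of_norm_le (exp_neg_integrableOn_Ioi 0 hε) ?_
    filter_upwards [ae_restrict_mem measurableSet_Ioi] with t ht
    exact hG.norm_abelIntegrand_le ε (le_of_lt ht) hρ
  rw [integral_exp_mul_Ioi (neg_lt_zero.2 hε)] at h1
  rw [abelAverage, norm_smul, Complex.norm_real, Real.norm_eq_abs, abs_of_pos hε]
  refine (mul_le_mul_of_nonneg_left h1 hε.le).trans_eq ?_
  simp [hε.ne']

/-- `ε⁻¹ 𝓐_ε` acts as the resolvent of `𝓛`: integrate the derivative of `e^{-tε} e^{t𝓛}(ρ)` over the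
half line, where the boundary term at infinity vanishes. -/
theorem smul_abelAverage_sub_lindbladian {ε : ℝ} (hε : 0 < ε) {ρ : Op Λ} (hρ : IsState ρ) :
    (ε : ℂ) • T.abelAverage ε ρ - T.lindbladian (T.abelAverage ε ρ) = (ε : ℂ) • ρ := by
  set M : Op Λ →L[ℂ] Op Λ := generator (drift H J) Φ - (ε : ℂ) • (1 : Op Λ →L[ℂ] Op Λ) with hM
  have hint := hG.integrableOn_abelIntegrand hε hρ
  have htend : Tendsto (T.abelIntegrand ε ρ) atTop (𝓝 0) := by
    have h1 : Tendsto (fun t : ℝ => Real.exp (-ε * t)) atTop (𝓝 0) :=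
      Real.tendsto_exp_atBot.comp (tendsto_id.const_mul_atTop_of_neg (neg_lt_zero.2 hε))
    refine squeeze_zero_norm' ?_ h1
    filter_upwards [eventually_ge_atTop 0] with t ht
    exact hG.norm_abelIntegrand_le ε ht hρ
  have h1 := integral_Ioi_of_hasDerivAt_of_tendsto'
    (fun t (_ : t ∈ Set.Ici (0 : ℝ)) => hG.hasDerivAt_abelIntegrand ε ρ t)
    (M.integrable_comp hint) htend
  have h0 : T.abelIntegrand ε ρ 0 = ρ := by
    rw [abelIntegrand, hG.evolution_eq, expSemigroup_zero]
    simp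
  rw [ContinuousLinearMap.integral_comp_comm _ hint, h0, zero_sub] at h1
  have h2 : M (T.abelAverage ε ρ) = -((ε : ℂ) • ρ) := by
    rw [abelAverage, map_smul, h1, smul_neg]
  rw [hG.lindbladian_eq, ← neg_sub, ← neg_eq_iff_eq_neg.2 h2]
  rfl

end LindbladTerms.IsGenerator

end Evolution

/-! ### Dissipativity of the local non-hermitian generators -/

section NonHermitian

open ComplexConjugate

namespace LindbladTerms

variable {T : LindbladTerms Λ} {R N γ : ℝ} {I m : ℕ}

/-- The local term `-i h_Z - (1/2) ∑_{α ∈ I_Z} L_α^* L_α`. -/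
def localDrift (T : LindbladTerms Λ) (Z : Finset Λ) : Op Λ := drift (T.ham Z) (T.jumpSq Z)

theorem nonHermitian_apply (T : LindbladTerms Λ) (Ω : Finset Λ) (u v : Ω) :
    T.nonHermitian Ω u v
      = elt (drift (∑ Z ∈ Ω.powerset, T.ham Z) (∑ Z ∈ Ω.powerset, T.jumpSq Z)) u v := rfl

theorem drift_sum (T : LindbladTerms Λ) (F : Finset (Finset Λ)) :
    drift (∑ Z ∈ F, T.ham Z) (∑ Z ∈ F, T.jumpSq Z) = ∑ Z ∈ F, T.localDrift Z := by
  simp only [drift, localDrift, Finset.sum_sub_distrib, Finset.smul_sum]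

theorem nonHermitian_eq_sum (T : LindbladTerms Λ) (Ω : Finset Λ) (u v : Ω) :
    T.nonHermitian Ω u v = ∑ Z ∈ Ω.powerset, elt (T.localDrift Z) u v := by
  rw [nonHermitian_apply, drift_sum]
  simp only [elt, sum_apply, inner_sum]

/-- A bound on the norm of the local terms `-i h_Z - (1/2) ∑_{α ∈ I_Z} L_α^* L_α`. -/
def driftBound (I : ℕ) (N : ℝ) : ℝ := |N| + I * N ^ 2 / 2

theorem driftBound_nonneg (I : ℕ) (N : ℝ) : 0 ≤ driftBound I N := by
  unfold driftBound
  positivity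

namespace IsLocal

variable (hT : T.IsLocal R I N)
include hT

theorem localDrift_actsIn (Z : Finset Λ) : ActsIn (T.localDrift Z) Z := by
  have h1 := hT.ham_actsIn Z
  have h2 := hT.jumpSq_actsIn Z
  constructor
  · rw [localDrift, drift, mul_sub, mul_smul_comm, mul_smul_comm, h1.1, h2.1]
  · rw [localDrift, drift, sub_mul, smul_mul_assoc, smul_mul_assoc, h1.2, h2.2]

theorem localDrift_eq_zero {Z : Finset Λ} (h : ¬ DiamLE Z R) : T.localDrift Z = 0 := by
  rw [localDrift, drift, hT.ham_eq_zero Z h, hT.jumpSq_eq_zero h, smul_zero, smul_zero, sub_zero]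

theorem norm_localDrift_le (Z : Finset Λ) : ‖T.localDrift Z‖ ≤ driftBound I N := by
  have h1 := (hT.norm_ham_le Z).trans (le_abs_self N)
  have h2 := hT.norm_jumpSq_le Z
  refine (norm_sub_le _ _).trans ?_
  rw [norm_smul, norm_smul, norm_neg, Complex.norm_I, one_mul, driftBound]
  norm_num
  linarith

/-- Only sets containing `u` of diameter at most `R` contribute, at most `2 ^ m` of them, so the
bound is uniform in `F`. -/
theorem norm_sum_localDrift_apply_le (hm : ∀ x : Λ, (ball x R).card ≤ m)
    (F : Finset (Finset Λ)) (f : Ell2 Λ) (u : Λ) :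
    ‖∑ Z ∈ F, T.localDrift Z f u‖ ≤ 2 ^ m * driftBound I N * ‖f‖ := by
  classical
  have h1 : ∑ Z ∈ F, T.localDrift Z f u
      = ∑ Z ∈ F.filter fun Z => u ∈ Z ∧ DiamLE Z R, T.localDrift Z f u := by
    refine (Finset.sum_filter_of_ne fun Z _ hne => ?_).symm
    by_contra hcon
    rw [not_and_or] at hcon
    rcases hcon with hu | hd
    · exact hne ((hT.localDrift_actsIn Z).apply_eq_zero hu f)
    · rw [hT.localDrift_eq_zero hd] at hne
      exact hne rfl
  have h2 : ∀ Z, ‖T.localDrift Z f u‖ ≤ driftBound I N * ‖f‖ := fun Z =>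
    (lp.norm_apply_le_norm two_ne_zero _ _).trans
      ((T.localDrift Z).le_of_opNorm_le (hT.norm_localDrift_le Z) f)
  have h3 := card_le_two_pow_of_mem (hm u) (F.filter fun Z => u ∈ Z ∧ DiamLE Z R)
    fun Z hZ => (Finset.mem_filter.1 hZ).2
  rw [h1]
  refine (norm_sum_le _ _).trans ((Finset.sum_le_sum fun Z _ => h2 Z).trans ?_)
  rw [Finset.sum_const, nsmul_eq_mul, mul_assoc]
  refine mul_le_mul_of_nonneg_right (by exact_mod_cast h3) ?_
  exact mul_nonneg (driftBound_nonneg I N) (norm_nonneg _)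

theorem norm_nonHermitian_le (hm : ∀ x : Λ, (ball x R).card ≤ m) (Ω : Finset Λ) (u v : Ω) :
    ‖T.nonHermitian Ω u v‖ ≤ 2 ^ m * driftBound I N := by
  have := hT.norm_sum_localDrift_apply_le hm Ω.powerset (δ v.1) u
  rw [norm_delta, mul_one] at this
  simpa only [nonHermitian_eq_sum, elt_eq_apply] using this

theorem nonHermitian_eq_zero (Ω : Finset Λ) (u v : Ω) (h : v.1 ∉ ball u.1 R) :
    T.nonHermitian Ω u v = 0 := by
  rw [nonHermitian_eq_sum]
  refine Finset.sum_eq_zero fun Z _ => ?_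
  by_cases hd : DiamLE Z R
  · by_cases hu : u.1 ∈ Z
    · have hv : v.1 ∉ Z := fun hv => h (mem_ball.2 (hd u hu v hv))
      rw [← (hT.localDrift_actsIn Z).2, elt, mul_apply_eq_comp, proj_delta_of_notMem hv, map_zero,
        inner_zero_right]
    · rw [elt_eq_apply, (hT.localDrift_actsIn Z).apply_eq_zero hu]
  · rw [hT.localDrift_eq_zero hd, elt]
    simp

/-- The hermitian part of `D_Ω` is `-(1/2) ∑ L_α^* L_α` over `Z ⊆ Ω`, which is exactly what the gap
condition bounds for this `Ω`. -/
theorem isDissipative_one (hγ : T.HasUniformGap γ) (Ω : Finset Λ) :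
    IsDissipative (T.nonHermitian Ω) (fun _ => 1) γ := by
  classical
  intro w
  set f : Ell2 Λ := ∑ u : Ω, w u • δ u.1 with hf
  set D := drift (∑ Z ∈ Ω.powerset, T.ham Z) (∑ Z ∈ Ω.powerset, T.jumpSq Z) with hD
  have hproj : proj Ω f = f := by
    rw [hf, map_sum]
    refine Finset.sum_congr rfl fun u _ => ?_
    rw [map_smul, proj_delta_of_mem u.2]
  have hfu : ∀ u : Ω, f u.1 = w u := by
    intro u
    rw [← inner_delta_left, hf, inner_sum, Finset.sum_eq_single u]
    · rw [inner_smul_right, inner_delta_left, delta_apply, if_pos rfl, mul_one]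
    · intro v _ hv
      have : u.1 ≠ v.1 := fun e => hv (Subtype.ext e.symm)
      simp [inner_smul_right, inner_delta_left, delta_apply, this]
    · simp
  have hnorm : ‖f‖ ^ 2 = ∑ u, ‖w u‖ ^ 2 := by
    rw [← hproj, norm_proj_sq, ← Finset.sum_coe_sort]
    exact Finset.sum_congr rfl fun u _ => by rw [hfu]
  have h1 : ∑ i, ∑ j, conj (w i) * ((((1 : ℝ)⁻¹ : ℝ) : ℂ) * T.nonHermitian Ω i j * ((1 : ℝ) : ℂ))
      * w j = ⟪f, D f⟫_ℂ := by
    conv_rhs => rw [hf, map_sum, sum_inner]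
    refine Finset.sum_congr rfl fun i _ => ?_
    rw [inner_sum]
    refine Finset.sum_congr rfl fun j _ => ?_
    rw [map_smul, inner_smul_left, inner_smul_right, nonHermitian_apply, elt]
    simp
    ring
  have hH : (∑ Z ∈ Ω.powerset, T.ham Z).adjoint = ∑ Z ∈ Ω.powerset, T.ham Z := by
    rw [map_sum]
    exact Finset.sum_congr rfl fun Z _ =>
      ContinuousLinearMap.isSelfAdjoint_iff'.1 (hT.ham_selfAdjoint Z)
  have h2 := re_inner_drift hH (∑ Z ∈ Ω.powerset, T.jumpSq Z) f
  have h3 := ((ContinuousLinearMap.le_def _ _).1 (hγ Ω)).re_inner_nonneg_right f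
  rw [sub_apply, inner_sub_right, smul_apply, smul_apply, inner_smul_right, inner_smul_right, hproj,
    inner_self_eq_norm_sq_to_K, map_sub] at h3
  have h4 : ((γ : ℂ) * ((‖f‖ : ℂ)) ^ 2).re = γ * ‖f‖ ^ 2 := by
    rw [← Complex.ofReal_pow, ← Complex.ofReal_mul, Complex.ofReal_re]
  have h5 : ((1 / 2 : ℂ) * ⟪f, (∑ Z ∈ Ω.powerset, T.jumpSq Z) f⟫_ℂ).re
      = 1 / 2 * (⟪f, (∑ Z ∈ Ω.powerset, T.jumpSq Z) f⟫_ℂ).re := by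
    have : (1 / 2 : ℂ) = ((1 / 2 : ℝ) : ℂ) := by push_cast; rfl
    rw [this, Complex.re_ofReal_mul]
  have h6 : 0 ≤ ((1 / 2 : ℂ) * ⟪f, (∑ Z ∈ Ω.powerset, T.jumpSq Z) f⟫_ℂ).re
      - ((γ : ℂ) * ((‖f‖ : ℂ)) ^ 2).re := h3
  rw [h1, ← hnorm]
  linarith

/-- Conjugation with slowly varying exponential weights preserves dissipativity. -/
theorem isDissipative_exp (hm : ∀ x : Λ, (ball x R).card ≤ m) (hγ : T.HasUniformGap γ) {ν : ℝ}
    (hν : 0 ≤ ν) (hνγ : (Real.exp (ν * |R|) - 1) * (2 ^ m * driftBound I N) * m ≤ γ / 2)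
    (x : Λ) (Ω : Finset Λ) (hΩ : ∀ u ∈ Ω, FiniteDist x u) :
    IsDissipative (T.nonHermitian Ω) (fun u => Real.exp (ν * gdist x u.1)) (γ / 2) := by
  classical
  intro w
  set p : Ω → ℝ := fun u => Real.exp (ν * gdist x u.1) with hp
  set η := (Real.exp (ν * |R|) - 1) * (2 ^ m * driftBound I N) with hη
  have hκ : 0 ≤ 2 ^ m * driftBound I N := mul_nonneg (by positivity) (driftBound_nonneg I N)
  have he : 0 ≤ Real.exp (ν * |R|) - 1 := by
    have := Real.one_le_exp (show 0 ≤ ν * |R| by positivity)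
    linarith
  have hη0 : 0 ≤ η := mul_nonneg he hκ
  have hexp : ∀ s : ℝ, |Real.exp s - 1| ≤ Real.exp |s| - 1 := by
    intro s
    rcases le_total 0 s with hs | hs
    · have := Real.one_le_exp hs
      rw [abs_of_nonneg hs, abs_of_nonneg (by linarith)]
    · have h1 := Real.exp_le_one_iff.2 hs
      have h2 := Real.add_one_le_exp s
      have h3 := Real.add_one_le_exp (-s)
      rw [abs_of_nonpos hs, abs_of_nonpos (by linarith)]
      have h4 : Real.exp s * Real.exp (-s) = 1 := by rw [← Real.exp_add]; simp
      nlinarith [Real.exp_pos s, Real.exp_pos (-s)]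
  -- Entries vanish beyond distance `R`, and within it the two weights have a ratio between
  -- `exp(-ν|R|)` and `exp(ν|R|)`.
  have hpw : ∀ i j, ‖T.nonHermitian Ω i j‖ * |(p i)⁻¹ * p j - 1|
      ≤ if j.1 ∈ ball i.1 R then η else 0 := by
    intro i j
    split_ifs with hb
    · have hij := mem_ball.1 hb
      have h1 : (p i)⁻¹ * p j = Real.exp (ν * (gdist x j.1 - gdist x i.1)) := by
        rw [hp, ← Real.exp_neg, ← Real.exp_add]
        congr 1
        ring
      have h2 : |gdist x j.1 - gdist x i.1| ≤ |R| := by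
        have h3 := gdist_triangle (hΩ i i.2) j.1
        have h4 := gdist_triangle (hΩ j j.2) i.1
        rw [gdist_comm j.1 i.1] at h4
        have := hij.2.trans (le_abs_self R)
        rw [abs_le]
        constructor <;> linarith
      rw [h1, hη, mul_comm]
      refine mul_le_mul ?_ (hT.norm_nonHermitian_le hm Ω i j) (norm_nonneg _) he
      refine (hexp _).trans ?_
      rw [abs_mul, abs_of_nonneg hν]
      gcongr
    · rw [hT.nonHermitian_eq_zero Ω i j hb, norm_zero, zero_mul]
  have hcard : ∀ i : Ω, ∑ j : Ω, (if j.1 ∈ ball i.1 R then η else 0) ≤ η * m := by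
    intro i
    rw [Finset.sum_coe_sort Ω (fun j => if j ∈ ball i.1 R then η else 0), ← Finset.sum_filter,
      Finset.sum_const, nsmul_eq_mul, mul_comm]
    refine mul_le_mul_of_nonneg_left ?_ hη0
    have : (Ω.filter fun j => j ∈ ball i.1 R).card ≤ (ball i.1 R).card :=
      Finset.card_le_card fun j hj => (Finset.mem_filter.1 hj).2
    exact_mod_cast this.trans (hm i.1)
  have hsymm : ∀ i j : Ω, (if j.1 ∈ ball i.1 R then η else 0)
      = if i.1 ∈ ball j.1 R then η else 0 := by
    intro i j
    have : j.1 ∈ ball i.1 R ↔ i.1 ∈ ball j.1 R := by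
      rw [mem_ball, mem_ball, gdist_comm]
      exact and_congr_left fun _ => ⟨SimpleGraph.Reachable.symm, SimpleGraph.Reachable.symm⟩
    simp only [this]
  have hsplit : ∑ i, ∑ j, conj (w i) * (((p i)⁻¹ : ℝ) * T.nonHermitian Ω i j * (p j : ℝ)) * w j
      = (∑ i, ∑ j, conj (w i) * ((((1 : ℝ)⁻¹ : ℝ) : ℂ) * T.nonHermitian Ω i j * ((1 : ℝ) : ℂ))
          * w j)
        + ∑ i, ∑ j, conj (w i) * T.nonHermitian Ω i j * w j * (((p i)⁻¹ * p j - 1 : ℝ) : ℂ) := by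
    simp only [← Finset.sum_add_distrib]
    refine Finset.sum_congr rfl fun i _ => Finset.sum_congr rfl fun j _ => ?_
    push_cast
    ring
  -- Schur test: the perturbation is dominated by a symmetric kernel with row sums at most `η * m`,
  -- which the choice of `ν` keeps below `γ / 2`.
  have hrest : (∑ i, ∑ j, conj (w i) * T.nonHermitian Ω i j * w j
      * (((p i)⁻¹ * p j - 1 : ℝ) : ℂ)).re ≤ η * m * ∑ i, ‖w i‖ ^ 2 := by
    have h1 : ∀ i j, (conj (w i) * T.nonHermitian Ω i j * w j
        * (((p i)⁻¹ * p j - 1 : ℝ) : ℂ)).re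
        ≤ (if j.1 ∈ ball i.1 R then η else 0) * ‖w i‖ ^ 2 / 2
          + (if i.1 ∈ ball j.1 R then η else 0) * ‖w j‖ ^ 2 / 2 := by
      intro i j
      refine (Complex.re_le_norm _).trans ?_
      rw [norm_mul, norm_mul, norm_mul, Complex.norm_conj, Complex.norm_real, Real.norm_eq_abs,
        ← hsymm i j]
      have h2 := hpw i j
      have h3 : 0 ≤ (if j.1 ∈ ball i.1 R then η else 0) := by split_ifs <;> simp [hη0]
      calc ‖w i‖ * ‖T.nonHermitian Ω i j‖ * ‖w j‖ * |(p i)⁻¹ * p j - 1|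
          = (‖T.nonHermitian Ω i j‖ * |(p i)⁻¹ * p j - 1|) * (‖w i‖ * ‖w j‖) := by ring
        _ ≤ (if j.1 ∈ ball i.1 R then η else 0) * (‖w i‖ * ‖w j‖) := by gcongr
        _ ≤ (if j.1 ∈ ball i.1 R then η else 0) * ((‖w i‖ ^ 2 + ‖w j‖ ^ 2) / 2) := by
            refine mul_le_mul_of_nonneg_left ?_ h3
            linarith [two_mul_le_add_sq ‖w i‖ ‖w j‖]
        _ = _ := by ring
    rw [Complex.re_sum]
    simp only [Complex.re_sum]
    refine (Finset.sum_le_sum fun i _ => Finset.sum_le_sum fun j _ => h1 i j).trans ?_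
    simp only [Finset.sum_add_distrib]
    have h2 : ∑ i : Ω, ∑ j : Ω, (if j.1 ∈ ball i.1 R then η else 0) * ‖w i‖ ^ 2 / 2
        ≤ η * m * (∑ i, ‖w i‖ ^ 2) / 2 := by
      rw [Finset.mul_sum, Finset.sum_div]
      refine Finset.sum_le_sum fun i _ => ?_
      rw [← Finset.sum_div, ← Finset.sum_mul]
      gcongr
      exact hcard i
    have h3 : ∑ i : Ω, ∑ j : Ω, (if i.1 ∈ ball j.1 R then η else 0) * ‖w j‖ ^ 2 / 2
        ≤ η * m * (∑ i, ‖w i‖ ^ 2) / 2 := by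
      rw [Finset.sum_comm]
      exact h2
    linarith
  have h1 := hT.isDissipative_one hγ Ω w
  rw [hsplit, Complex.add_re]
  have h2 : 0 ≤ ∑ i, ‖w i‖ ^ 2 := by positivity
  have h3 := mul_le_mul_of_nonneg_right hνγ h2
  linarith

end IsLocal

end LindbladTerms

end NonHermitian

/-! ### The block equation and the main estimates -/

section Block

open ComplexConjugate

namespace LindbladTerms

variable {T : LindbladTerms Λ} {R N γ : ℝ} {I m : ℕ} {H J : Op Λ} {Φ : Op Λ →L[ℂ] Op Λ}

theorem elt_adjoint (X : Op Λ) (u v : Λ) : elt X.adjoint u v = conj (elt X v u) := by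
  rw [elt, elt, ContinuousLinearMap.adjoint_inner_right, inner_conj_symm]

theorem IsGenerator.hasSum_localDrift (hG : T.IsGenerator H J Φ) (f : Ell2 Λ) (u : Λ) :
    HasSum (fun Z => T.localDrift Z f u) (drift H J f u) := by
  have h1 := ((hG.ham f).const_smul (-Complex.I)).sub ((hG.jumpSq f).const_smul (1 / 2 : ℂ))
  have h2 := h1.mapL (innerSL ℂ (δ u))
  simp only [innerSL_apply_apply, inner_delta_left] at h2
  exact h2

/-- Two-sided jump terms do not couple points at distance larger than `R`. -/
theorem elt_jumpConj_eq_zero (hT : T.IsLocal R I N) (hG : T.IsGenerator H J Φ) (X : Op Λ)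
    {u v : Λ} (h : v ∉ ball u R) : elt (Φ X) u v = 0 := by
  have h1 : HasSum (fun Z => T.jumpConj Z X (δ v) u) (Φ X (δ v) u) := by
    have := (hG.jumpConj X (δ v)).mapL (innerSL ℂ (δ u))
    simpa only [innerSL_apply_apply, inner_delta_left] using this
  rw [elt_eq_apply]
  refine h1.unique ?_
  convert hasSum_zero (α := ℂ) using 2 with Z
  by_cases hd : DiamLE Z R
  · by_cases hu : u ∈ Z
    · have hv : v ∉ Z := fun hv => h (mem_ball.2 (hd u hu v hv))
      rw [← (hT.jumpConj_actsIn Z X).2, mul_apply_eq_comp, proj_delta_of_notMem hv, map_zero]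
      rfl
    · exact (hT.jumpConj_actsIn Z X).apply_eq_zero hu _
  · rw [hT.jumpConj_eq_zero hd]
    rfl

/-- Up to an exponentially small boundary term, the drift in a ball is the local one. -/
theorem norm_drift_sub_nonHermitian_le (hT : T.IsLocal R I N) (hG : T.IsGenerator H J Φ)
    (hm : ∀ x : Λ, (ball x R).card ≤ m) {μ r : ℝ} (hμ : 0 ≤ μ) (x : Λ) (u : ball x r)
    (f : Ell2 Λ) :
    ‖drift H J f u.1 - ∑ w, T.nonHermitian (ball x r) u w * f w.1‖
      ≤ 2 ^ m * driftBound I N * ‖f‖ * Real.exp (μ * (gdist x u.1 - r + R)) := by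
  classical
  -- A term acting at `u` has its set inside the `R`-ball of `u`; adjoining all subsets of the large
  -- ball lets the local generator be subtracted termwise.
  set F := (ball u.1 R).powerset ∪ (ball x r).powerset with hF
  have h1 : drift H J f u.1 = ∑ Z ∈ F, T.localDrift Z f u.1 := by
    refine (hG.hasSum_localDrift f u.1).unique (hasSum_sum_of_ne_finset_zero fun Z hZ => ?_)
    by_cases hd : DiamLE Z R
    · by_cases hu : u.1 ∈ Z
      · exact (hZ (Finset.mem_union_left _ (Finset.mem_powerset.2 fun w hw =>
          mem_ball.2 (hd _ hu _ hw)))).elim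
      · exact (hT.localDrift_actsIn Z).apply_eq_zero hu f
    · rw [hT.localDrift_eq_zero hd]
      rfl
  have h2 : ∑ w, T.nonHermitian (ball x r) u w * f w.1 = ∑ Z ∈ (ball x r).powerset, T.localDrift Z f u.1 := by
    have e1 : ∀ Z ∈ (ball x r).powerset, T.localDrift Z f u.1
        = ∑ w : (ball x r), elt (T.localDrift Z) u.1 w.1 * f w.1 := by
      intro Z hZ
      rw [(hT.localDrift_actsIn Z).apply_eq_sum (Finset.mem_powerset.1 hZ),
        Finset.sum_coe_sort (ball x r) (fun w => elt (T.localDrift Z) u.1 w * f w)]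
    rw [Finset.sum_congr rfl e1, Finset.sum_comm]
    refine Finset.sum_congr rfl fun w _ => ?_
    rw [nonHermitian_eq_sum, Finset.sum_mul]
  have h3 : drift H J f u.1 - ∑ w, T.nonHermitian (ball x r) u w * f w.1
      = ∑ Z ∈ F \ (ball x r).powerset, T.localDrift Z f u.1 := by
    rw [h1, h2, ← Finset.sum_sdiff (Finset.subset_union_right : (ball x r).powerset ⊆ F)]
    ring
  have hκ : 0 ≤ 2 ^ m * driftBound I N * ‖f‖ :=
    mul_nonneg (mul_nonneg (by positivity) (driftBound_nonneg I N)) (norm_nonneg _)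
  rw [h3]
  -- In the interior no term acting at `u` reaches outside the ball and the difference vanishes.
  -- Within `R` of the edge the exponential is at least `1`, so the crude bound is enough.
  by_cases hb : gdist x u.1 ≤ r - R
  · have h4 : ∑ Z ∈ F \ (ball x r).powerset, T.localDrift Z f u.1 = 0 := by
      refine Finset.sum_eq_zero fun Z hZ => ?_
      by_cases hd : DiamLE Z R
      · by_cases hu : u.1 ∈ Z
        · refine ((Finset.mem_sdiff.1 hZ).2 (Finset.mem_powerset.2 fun w hw => ?_)).elim
          have h5 := hd _ hu _ hw
          have h6 := (mem_ball.1 u.2).1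
          refine mem_ball.2 ⟨h6.trans h5.1, ?_⟩
          have := gdist_triangle h6 w
          linarith [h5.2]
        · exact (hT.localDrift_actsIn Z).apply_eq_zero hu f
      · rw [hT.localDrift_eq_zero hd]
        rfl
    rw [h4, norm_zero]
    exact mul_nonneg hκ (Real.exp_pos _).le
  · refine (hT.norm_sum_localDrift_apply_le hm _ f u.1).trans (le_mul_of_one_le_right hκ ?_)
    refine Real.one_le_exp (mul_nonneg hμ ?_)
    linarith

/-- The matrix block of `X` over the balls `Λ_x` and `Λ_y`. -/
def block (X : Op Λ) (x y : Λ) : Matrix (third x y) (third y x) ℂ :=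
  Matrix.of fun u v => elt X u.1 v.1

/-- Two balls of radius `d/3` leave a distance of at least `d/3 > R` between their points. -/
theorem notMem_ball_of_mem_third {x y u v : Λ} (hd : 3 * R < gdist x y)
    (hu : u ∈ third x y) (hv : v ∈ third y x) : v ∉ ball u R := by
  intro h
  have hu := mem_third.1 hu
  have hv := mem_third.1 hv
  have h := mem_ball.1 h
  have h1 := gdist_triangle hu.1 y
  have h2 := gdist_triangle h.1 y
  rw [gdist_comm v y] at h2
  rw [gdist_comm y x] at hv
  linarith [h.2, hu.2, hv.2]

/-- The block of an almost stationary operator solves a Sylvester equation up to boundary terms. -/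
theorem norm_sylvester_block_le (hT : T.IsLocal R I N) (hG : T.IsGenerator H J Φ)
    (hm : ∀ x : Λ, (ball x R).card ≤ m) {μ ε : ℝ} (hμ : 0 ≤ μ) (hε : 0 ≤ ε) {X ρ : Op Λ}
    (hX : ‖X‖ ≤ 1) (hXρ : (ε : ℂ) • X - T.lindbladian X = (ε : ℂ) • ρ) {x y : Λ}
    (hd : 3 * R < gdist x y) (u : third x y) (v : third y x) :
    ‖sylvester (T.nonHermitian (third x y)) (T.nonHermitian (third y x)) ε (block X x y) u v‖
      ≤ ε * ‖elt ρ u.1 v.1‖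
        + 2 ^ m * driftBound I N * Real.exp (μ * (gdist x u.1 - gdist x y / 3 + R))
        + 2 ^ m * driftBound I N * Real.exp (μ * (gdist y v.1 - gdist x y / 3 + R)) := by
  set K := drift H J with hK
  set κ := 2 ^ m * driftBound I N with hκ
  have hκ0 : 0 ≤ κ := mul_nonneg (by positivity) (driftBound_nonneg I N)
  have h1 : (ε : ℂ) * elt X u.1 v.1
      - (K (X (δ v.1)) u.1 + conj (K (X.adjoint (δ u.1)) v.1)) = ε * elt ρ u.1 v.1 := by
    have e1 := congrArg (fun A => elt A u.1 v.1) hXρ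
    -- Taking adjoints turns the right multiplication into the drift acting on a vector, so the same
    -- boundary estimate serves both balls.
    have e2 : elt (X * K.adjoint) u.1 v.1 = conj (K (X.adjoint (δ u.1)) v.1) := by
      have e := elt_adjoint (K * X.adjoint) u.1 v.1
      rw [ContinuousLinearMap.mul_def, ContinuousLinearMap.adjoint_comp,
        ContinuousLinearMap.adjoint_adjoint, elt_eq_apply _ v.1] at e
      exact e
    have e3 := elt_jumpConj_eq_zero hT hG X (notMem_ball_of_mem_third hd u.2 v.2)
    rw [← e2, ← add_zero (_ + elt (X * K.adjoint) u.1 v.1), ← e3]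
    rw [hG.lindbladian_eq, generator_apply] at e1
    simp only [elt, sub_apply, add_apply, smul_apply, inner_sub_right, inner_add_right,
      inner_smul_right] at e1 ⊢
    rw [← inner_delta_left]
    exact e1
  set b1 := K (X (δ v.1)) u.1 - ∑ w, T.nonHermitian (third x y) u w * X (δ v.1) w.1 with hb1
  set b2 := K (X.adjoint (δ u.1)) v.1
    - ∑ w, T.nonHermitian (third y x) v w * X.adjoint (δ u.1) w.1 with hb2
  have h2 : sylvester (T.nonHermitian (third x y)) (T.nonHermitian (third y x)) ε (block X x y) u v
      = ε * elt ρ u.1 v.1 + b1 + conj b2 := by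
    have e1 : ∑ l, block X x y u l * conj (T.nonHermitian (third y x) v l)
        = conj (∑ w, T.nonHermitian (third y x) v w * X.adjoint (δ u.1) w.1) := by
      rw [map_sum]
      refine Finset.sum_congr rfl fun l _ => ?_
      rw [map_mul, mul_comm, ← elt_eq_apply, elt_adjoint, Complex.conj_conj]
      rfl
    have e2 : ∑ k, T.nonHermitian (third x y) u k * block X x y k v
        = ∑ w, T.nonHermitian (third x y) u w * X (δ v.1) w.1 := by
      refine Finset.sum_congr rfl fun k _ => ?_
      rw [← elt_eq_apply]
      rfl
    rw [sylvester_apply, e1, e2, ← h1, hb1, hb2, map_sub]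
    simp only [block, Matrix.of_apply]
    ring
  have hnorm : ∀ A : Op Λ, ‖A‖ ≤ 1 → ∀ z, ‖A (δ z)‖ ≤ 1 := by
    intro A hA z
    have := A.le_of_opNorm_le hA (δ z)
    rwa [norm_delta, mul_one] at this
  have hb1n : ‖b1‖ ≤ κ * Real.exp (μ * (gdist x u.1 - gdist x y / 3 + R)) := by
    refine (norm_drift_sub_nonHermitian_le hT hG hm hμ x u _).trans ?_
    gcongr
    exact mul_le_of_le_one_right hκ0 (hnorm X hX _)
  have hb2n : ‖b2‖ ≤ κ * Real.exp (μ * (gdist y v.1 - gdist x y / 3 + R)) := by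
    have hX' : ‖X.adjoint‖ ≤ 1 := by rwa [LinearIsometryEquiv.norm_map]
    refine (norm_drift_sub_nonHermitian_le hT hG hm hμ y v _).trans ?_
    refine mul_le_mul (mul_le_of_le_one_right hκ0 (hnorm _ hX' _)) (le_of_eq ?_)
      (Real.exp_pos _).le hκ0
    simp only [gdist_comm y x]
  rw [h2]
  refine (norm_add₃_le).trans ?_
  rw [norm_mul, Complex.norm_real, Real.norm_eq_abs, abs_of_nonneg hε, Complex.norm_conj]
  linarith

/-- Exponential decay of the off-diagonal matrix elements of almost stationary operators. -/
theorem norm_elt_le_of_almost_stationary (hT : T.IsLocal R I N) (hG : T.IsGenerator H J Φ)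
    (hm : ∀ x : Λ, (ball x R).card ≤ m) (hγ0 : 0 < γ) (hγ : T.HasUniformGap γ) {μ ε S : ℝ}
    (hμ : 0 ≤ μ) (hμγ : (Real.exp (2 * μ * |R|) - 1) * (2 ^ m * driftBound I N) * m ≤ γ / 2)
    (hS : ∀ (x : Λ) (s : Finset Λ), (∀ u ∈ s, FiniteDist x u) →
      ∑ u ∈ s, Real.exp (-μ * gdist x u) ≤ S) (hS0 : 0 ≤ S)
    (hε : 0 ≤ ε) {X ρ : Op Λ}
    (hX : ‖X‖ ≤ 1) (hXρ : (ε : ℂ) • X - T.lindbladian X = (ε : ℂ) • ρ) {x y : Λ}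
    (hd : 3 * R < gdist x y) :
    ‖elt X x y‖
      ≤ 2 * γ⁻¹ * (2 ^ m * driftBound I N) * Real.exp (μ * R) * S ^ 2
            * Real.exp (-μ * gdist x y / 3)
        + ε * γ⁻¹ * ∑ u ∈ third x y, ∑ v ∈ third y x,
            Real.exp (-μ * gdist x u) * Real.exp (-μ * gdist y v) * ‖elt ρ u v‖ := by
  set κ := 2 ^ m * driftBound I N with hκ
  have hκ0 : 0 ≤ κ := mul_nonneg (by positivity) (driftBound_nonneg I N)
  -- The weights grow at rate `2μ`, giving the Green function decay `(ex ey)²`. One factor `ex ey`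
  -- is kept to make the sums over `u` and `v` converge; the other compensates the growth of the
  -- boundary terms away from the centres and leaves `exp(-μ d/3)`.
  have hx := hT.isDissipative_exp hm hγ (by positivity : 0 ≤ 2 * μ) hμγ x (third x y)
    fun u hu => (mem_third.1 hu).1
  have hy := hT.isDissipative_exp hm hγ (by positivity : 0 ≤ 2 * μ) hμγ y (third y x)
    fun u hu => (mem_third.1 hu).1
  have h1 := hx.norm_le_sum_sylvester hy (fun _ => Real.exp_pos _) (fun _ => Real.exp_pos _)
    (half_pos hγ0) hε (block X x y) ⟨x, self_mem_third x y⟩ ⟨y, self_mem_third y x⟩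
  simp only [gdist_self, mul_zero, Real.exp_zero, mul_one] at h1
  refine h1.trans ?_
  set B := 2 * γ⁻¹ * κ * Real.exp (μ * R) * Real.exp (-μ * gdist x y / 3) with hB
  set ex : Λ → ℝ := fun u => Real.exp (-μ * gdist x u) with hex
  set ey : Λ → ℝ := fun v => Real.exp (-μ * gdist y v) with hey
  have hterm : ∀ (u : third x y) (v : third y x),
      (2 * (γ / 2))⁻¹ * (1 / (Real.exp (2 * μ * gdist x u.1) * Real.exp (2 * μ * gdist y v.1)))
        * ‖sylvester (T.nonHermitian (third x y)) (T.nonHermitian (third y x)) ε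
            (block X x y) u v‖
      ≤ B * (ex u.1 * ey v.1) + ε * γ⁻¹ * (ex u.1 * ey v.1 * ‖elt ρ u.1 v.1‖) := by
    intro u v
    have h2 := norm_sylvester_block_le hT hG hm hμ hε hX hXρ hd u v
    have hex1 : ex u.1 ≤ 1 := Real.exp_le_one_iff.2 (by
      have := mul_nonneg hμ (gdist_nonneg x u.1); linarith)
    have hey1 : ey v.1 ≤ 1 := Real.exp_le_one_iff.2 (by
      have := mul_nonneg hμ (gdist_nonneg y v.1); linarith)
    have hex0 : 0 < ex u.1 := Real.exp_pos _
    have hey0 : 0 < ey v.1 := Real.exp_pos _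
    have e1 : (2 * (γ / 2))⁻¹
        * (1 / (Real.exp (2 * μ * gdist x u.1) * Real.exp (2 * μ * gdist y v.1)))
        = γ⁻¹ * ((ex u.1 * ey v.1) * (ex u.1 * ey v.1)) := by
      rw [mul_div_cancel₀ _ two_ne_zero, one_div, ← Real.exp_add, ← Real.exp_neg]
      simp only [hex, hey, ← Real.exp_add]
      congr 2
      ring
    have e2 : Real.exp (μ * (gdist x u.1 - gdist x y / 3 + R)) * ex u.1
        = Real.exp (μ * R) * Real.exp (-μ * gdist x y / 3) := by
      simp only [hex, ← Real.exp_add]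
      congr 1
      ring
    have e3 : Real.exp (μ * (gdist y v.1 - gdist x y / 3 + R)) * ey v.1
        = Real.exp (μ * R) * Real.exp (-μ * gdist x y / 3) := by
      simp only [hey, ← Real.exp_add]
      congr 1
      ring
    set E := Real.exp (μ * R) * Real.exp (-μ * gdist x y / 3) with hE
    have hE0 : 0 ≤ E := by positivity
    set a := ex u.1
    set b := ey v.1
    set s1 := Real.exp (μ * (gdist x u.1 - gdist x y / 3 + R))
    set s2 := Real.exp (μ * (gdist y v.1 - gdist x y / 3 + R))
    set r := ‖elt ρ u.1 v.1‖ with hr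
    have hr0 : 0 ≤ r := norm_nonneg _
    have hγi : 0 < γ⁻¹ := inv_pos.2 hγ0
    rw [e1]
    calc γ⁻¹ * (a * b * (a * b)) * _
        ≤ γ⁻¹ * (a * b * (a * b)) * (ε * r + κ * s1 + κ * s2) := by gcongr
      _ = γ⁻¹ * (a * b) * (ε * r * (a * b) + κ * (s1 * a) * b + κ * (s2 * b) * a) := by ring
      _ ≤ γ⁻¹ * (a * b) * (ε * r * 1 + κ * E * 1 + κ * E * 1) := by
          rw [e2, e3]
          have hab : a * b ≤ 1 := mul_le_one₀ hex1 hey0.le hey1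
          gcongr
      _ = B * (a * b) + ε * γ⁻¹ * (a * b * r) := by rw [hB, hE]; ring
  refine (Finset.sum_le_sum fun u _ => Finset.sum_le_sum fun v _ => hterm u v).trans ?_
  simp only [Finset.sum_add_distrib, ← Finset.mul_sum]
  have hsx : ∑ u : third x y, ex u.1 ≤ S := by
    rw [Finset.sum_coe_sort (third x y) ex]
    exact hS x _ fun u hu => (mem_third.1 hu).1
  have hsy : ∑ v : third y x, ey v.1 ≤ S := by
    rw [Finset.sum_coe_sort (third y x) ey]
    exact hS y _ fun u hu => (mem_third.1 hu).1
  have hsx0 : 0 ≤ ∑ u : third x y, ex u.1 := Finset.sum_nonneg fun _ _ => (Real.exp_pos _).le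
  refine add_le_add ?_ (le_of_eq ?_)
  · simp only [← Finset.sum_mul]
    have hB0 : 0 ≤ B := by
      have := inv_pos.2 hγ0
      positivity
    calc B * ((∑ u : third x y, ex u.1) * ∑ v : third y x, ey v.1) ≤ B * (S * S) := by gcongr
      _ = _ := by rw [hB]; ring
  · congr 1
    rw [← Finset.sum_coe_sort (third x y)]
    refine Finset.sum_congr rfl fun u _ => ?_
    rw [← Finset.sum_coe_sort (third y x)]

/-- Exponential localisation of the kernel. -/
theorem norm_kernel_le (hT : T.IsLocal R I N) (hm : ∀ x : Λ, (ball x R).card ≤ m) (hγ0 : 0 < γ)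
    (hγ : T.HasUniformGap γ) {ν ε : ℝ} (hν : 0 ≤ ν)
    (hνγ : (Real.exp (ν * |R|) - 1) * (2 ^ m * driftBound I N) * m ≤ γ / 2) (hε : 0 ≤ ε) {x y : Λ}
    {Γ : ℝ → ℂ} (hΓ : IsAdmissibleContour T x y ε Γ) (u : third x y) (v : third y x) :
    ‖kernel T x y ε Γ u v‖
      ≤ γ⁻¹ * Real.exp (-ν * gdist x u.1) * Real.exp (-ν * gdist y v.1) := by
  have hx := hT.isDissipative_exp hm hγ hν hνγ x (third x y) fun u hu => (mem_third.1 hu).1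
  have hy := hT.isDissipative_exp hm hγ hν hνγ y (third y x) fun u hu => (mem_third.1 hu).1
  -- Unweighted dissipativity locates the spectrum relative to the contour; the decay comes from the
  -- weighted versions `hx` and `hy`. The kernel is the `(x, y)` entry of the resulting Green
  -- matrix.
  have h1 := sylvester_contourIntegral_eq_single hΓ.isContour hΓ.re_lt hΓ.winds
    (hT.isDissipative_one hγ (third y x)) hγ0 u v
  have h2 := hx.norm_le_of_sylvester_eq_single hy (fun _ => Real.exp_pos _)
    (fun _ => Real.exp_pos _) (half_pos hγ0) hε h1 ⟨x, self_mem_third x y⟩ ⟨y, self_mem_third y x⟩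
  simp only [gdist_self, mul_zero, Real.exp_zero, mul_one, Matrix.of_apply] at h2
  refine h2.trans_eq ?_
  rw [mul_div_cancel₀ _ two_ne_zero, one_div, mul_inv, ← Real.exp_neg, ← Real.exp_neg, mul_assoc,
    neg_mul, neg_mul]

/-- Local dephasing produces a uniform gap. -/
theorem hasUniformGap_of_dephasing (T : LindbladTerms Λ) (c : ℂ)
    (h : ∀ v : Λ, ∃ i, T.jump {v} i = c • InnerProductSpace.rankOne ℂ (δ v) (δ v)) :
    T.HasUniformGap (‖c‖ ^ 2 / 2) := by
  classical
  intro Ω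
  have hsum : ∀ F : Finset (Finset Λ), (∑ Z ∈ F, T.jumpSq Z).adjoint = ∑ Z ∈ F, T.jumpSq Z := by
    intro F
    rw [map_sum]
    exact Finset.sum_congr rfl fun Z _ => T.adjoint_jumpSq Z
  rw [ContinuousLinearMap.le_def, ContinuousLinearMap.isPositive_def']
  constructor
  · rw [ContinuousLinearMap.isSelfAdjoint_iff']
    have h1 : conj (1 / 2 : ℂ) = 1 / 2 := Complex.conj_eq_iff_im.2 (by norm_num)
    rw [map_sub, map_smulₛₗ, map_smulₛₗ, hsum, adjoint_proj, Complex.conj_ofReal, h1]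
  · intro f
    have h2 : ∀ Z, (⟪f, T.jumpSq Z f⟫_ℂ).re = ∑ i, ‖T.jump Z i f‖ ^ 2 := by
      intro Z
      rw [inner_jumpSq, Complex.ofReal_re]
    -- One dephasing operator per site suffices, since all further jumps only add non-negative
    -- terms.
    have h3 : ∀ v : Λ, ‖c‖ ^ 2 * ‖f v‖ ^ 2 ≤ ∑ i, ‖T.jump {v} i f‖ ^ 2 := by
      intro v
      obtain ⟨i, hi⟩ := h v
      refine le_trans (le_of_eq ?_)
        (Finset.single_le_sum (f := fun i => ‖T.jump {v} i f‖ ^ 2) (fun _ _ => by positivity)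
          (Finset.mem_univ i))
      simp only [hi, smul_apply, InnerProductSpace.rankOne_apply, inner_delta_left, norm_smul,
        norm_delta, mul_one, mul_pow]
    have h4 : ‖c‖ ^ 2 * ‖proj Ω f‖ ^ 2 ≤ ∑ Z ∈ Ω.powerset, ∑ i, ‖T.jump Z i f‖ ^ 2 := by
      rw [norm_proj_sq, Finset.mul_sum]
      refine (Finset.sum_le_sum fun v _ => h3 v).trans ?_
      rw [← Finset.sum_image (s := Ω) (g := fun v => ({v} : Finset Λ))
        (f := fun Z => ∑ i, ‖T.jump Z i f‖ ^ 2) fun _ _ _ _ e => Finset.singleton_injective e]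
      refine Finset.sum_le_sum_of_subset_of_nonneg ?_ fun _ _ _ => by positivity
      intro Z hZ
      obtain ⟨v, hv, rfl⟩ := Finset.mem_image.1 hZ
      exact Finset.mem_powerset.2 (Finset.singleton_subset_iff.2 hv)
    have h5 : (⟪f, proj Ω f⟫_ℂ) = ((‖proj Ω f‖ ^ 2 : ℝ) : ℂ) := by
      have hpp : proj Ω (proj Ω f) = proj Ω f := by
        rw [proj_apply Ω f, map_sum]
        exact Finset.sum_congr rfl fun v hv => by rw [map_smul, proj_delta_of_mem hv]
      rw [← hpp, ← inner_proj_left, inner_self_eq_norm_sq_to_K, hpp]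
      simp
    rw [ContinuousLinearMap.reApplyInnerSelf_apply, inner_re_symm]
    have h6 : (⟪f, (((1 / 2 : ℂ) • ∑ Z ∈ Ω.powerset, T.jumpSq Z)
        - ((‖c‖ ^ 2 / 2 : ℝ) : ℂ) • proj Ω) f⟫_ℂ).re
        = 1 / 2 * ∑ Z ∈ Ω.powerset, ∑ i, ‖T.jump Z i f‖ ^ 2
          - ‖c‖ ^ 2 / 2 * ‖proj Ω f‖ ^ 2 := by
      have h7 : (1 / 2 : ℂ) = ((1 / 2 : ℝ) : ℂ) := by push_cast; rfl
      rw [sub_apply, inner_sub_right, smul_apply, smul_apply, inner_smul_right, inner_smul_right,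
        Complex.sub_re, h7, Complex.re_ofReal_mul, Complex.re_ofReal_mul, h5, Complex.ofReal_re,
        sum_apply, inner_sum, Complex.re_sum]
      simp only [h2]
    have h8 : 0 ≤ 1 / 2 * ∑ Z ∈ Ω.powerset, ∑ i, ‖T.jump Z i f‖ ^ 2
          - ‖c‖ ^ 2 / 2 * ‖proj Ω f‖ ^ 2 := by linarith
    rw [← h6] at h8
    exact h8

end LindbladTerms

end Block

/-! ### Choice of the constants and assembly of the theorem -/

theorem exists_pos_exp_rate {γ L : ℝ} (hγ : 0 < γ) (hL : 0 ≤ L) (R : ℝ) :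
    ∃ μ : ℝ, 0 < μ ∧ (Real.exp (2 * μ * |R|) - 1) * L ≤ γ / 2 := by
  have hq : 0 < γ / 2 / (L + 1) := by positivity
  have hlog : 0 < Real.log (1 + γ / 2 / (L + 1)) := Real.log_pos (by linarith)
  have hR : 0 < |R| + 1 := by positivity
  -- `μ` solves `exp(2μ(|R| + 1)) = 1 + (γ/2)/(L + 1)`; the added ones cover `L = 0` and `R = 0`.
  refine ⟨Real.log (1 + γ / 2 / (L + 1)) / (2 * (|R| + 1)), by positivity, ?_⟩
  have h1 : Real.exp (2 * (Real.log (1 + γ / 2 / (L + 1)) / (2 * (|R| + 1))) * |R|)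
      ≤ 1 + γ / 2 / (L + 1) := by
    rw [← Real.le_log_iff_exp_le (by linarith)]
    have h2 : 2 * (Real.log (1 + γ / 2 / (L + 1)) / (2 * (|R| + 1))) * |R|
        = Real.log (1 + γ / 2 / (L + 1)) * (|R| / (|R| + 1)) := by
      field_simp
    rw [h2]
    exact mul_le_of_le_one_right hlog.le ((div_le_one hR).2 (by linarith))
  calc _ ≤ γ / 2 / (L + 1) * L := by gcongr; linarith
    _ ≤ γ / 2 / (L + 1) * (L + 1) := by gcongr; linarith
    _ = γ / 2 := div_mul_cancel₀ _ (by positivity)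

namespace LindbladTerms

variable {T : LindbladTerms Λ} {R N γ : ℝ} {I m : ℕ} {H J : Op Λ} {Φ : Op Λ →L[ℂ] Op Λ}

/-- Decay of almost stationary operators, without restriction on the distance. -/
theorem norm_elt_le_pow_mul_exp (hT : T.IsLocal R I N) (hG : T.IsGenerator H J Φ)
    (hm : ∀ x : Λ, (ball x R).card ≤ m) (hγ0 : 0 < γ) (hγ : T.HasUniformGap γ) {μ ε S C : ℝ}
    (hμ : 0 ≤ μ) (hμγ : (Real.exp (2 * μ * |R|) - 1) * (2 ^ m * driftBound I N * m) ≤ γ / 2)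
    (hS : ∀ (x : Λ) (s : Finset Λ), (∀ u ∈ s, FiniteDist x u) →
      ∑ u ∈ s, Real.exp (-μ * gdist x u) ≤ S) (hS0 : 0 ≤ S)
    (hCγ : γ⁻¹ ≤ C) (hCR : Real.exp (μ * R) ≤ C)
    (hCS : 2 * γ⁻¹ * (2 ^ m * driftBound I N) * Real.exp (μ * R) * S ^ 2 ≤ C)
    (hε : 0 ≤ ε) {X ρ : Op Λ} (hX : ‖X‖ ≤ 1)
    (hXρ : (ε : ℂ) • X - T.lindbladian X = (ε : ℂ) • ρ) {x y : Λ} (hxy : FiniteDist x y)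
    (hne : x ≠ y) (k : ℕ) :
    ‖elt X x y‖
      ≤ C * gdist x y ^ k * Real.exp (-μ * gdist x y / 3)
        + ε * C * ∑ u ∈ third x y, ∑ v ∈ third y x,
            Real.exp (-μ * gdist x u) * Real.exp (-μ * gdist y v) * ‖elt ρ u v‖ := by
  have hC : 0 ≤ C := (inv_pos.2 hγ0).le.trans hCγ
  -- Distinct points have distance at least `1`, so a polynomial factor of any degree only enlarges
  -- the bound.
  have hpow : 1 ≤ gdist x y ^ k := one_le_pow₀ (one_le_gdist hxy hne)
  have hCp : C ≤ C * gdist x y ^ k := le_mul_of_one_le_right hC hpow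
  have hsum : 0 ≤ ∑ u ∈ third x y, ∑ v ∈ third y x,
      Real.exp (-μ * gdist x u) * Real.exp (-μ * gdist y v) * ‖elt ρ u v‖ :=
    Finset.sum_nonneg fun _ _ => Finset.sum_nonneg fun _ _ => by positivity
  rcases le_or_gt (gdist x y) (3 * R) with hd | hd
  -- At distances up to `3R` the claimed bound already exceeds `1 ≥ ‖X‖`.
  · have h1 : 1 ≤ Real.exp (μ * R) * Real.exp (-μ * gdist x y / 3) := by
      rw [← Real.exp_add]
      refine Real.one_le_exp ?_
      have := mul_le_mul_of_nonneg_left hd hμ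
      linarith
    refine ((norm_elt_le X x y).trans hX).trans (h1.trans ?_)
    refine le_add_of_le_of_nonneg ?_ (mul_nonneg (mul_nonneg hε hC) hsum)
    exact mul_le_mul_of_nonneg_right (hCR.trans hCp) (Real.exp_pos _).le
  · rw [← mul_assoc] at hμγ
    refine (norm_elt_le_of_almost_stationary hT hG hm hγ0 hγ hμ hμγ hS hS0 hε hX hXρ hd).trans ?_
    exact add_le_add (mul_le_mul_of_nonneg_right (hCS.trans hCp) (Real.exp_pos _).le)
      (mul_le_mul_of_nonneg_right (mul_le_mul_of_nonneg_left hCγ hε) hsum)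

end LindbladTerms

end LindbladLattice

end

theorem mainTheorem2 (n : ℕ) (R : ℝ) (I : ℕ) (N γ : ℝ) (hγ : 0 < γ) :
    (∃ C μ : ℝ, 0 < C ∧ 0 < μ ∧
      ∀ (Λ : Set (Fin n → ℤ)) (T : LindbladTerms Λ), T.IsLocal R I N → T.HasUniformGap γ →
        -- the bound on the kernel
        (∀ x y : Λ, FiniteDist x y → ∀ ε : ℝ, 0 < ε →
          ∀ Γ : ℝ → ℂ, IsAdmissibleContour T x y ε Γ →
          ∀ (u : third x y) (v : third y x),
            ‖kernel T x y ε Γ u v‖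
              ≤ C * Real.exp (-μ * gdist x (u : Λ)) * Real.exp (-μ * gdist y (v : Λ))) ∧
        -- the bound on the Abel average of an arbitrary initial state
        (∀ ρ : Op Λ, IsState ρ → ∀ ε : ℝ, 0 < ε →
          MeasureTheory.IntegrableOn (T.abelIntegrand ε ρ) (Set.Ioi 0) ∧
          ∀ x y : Λ, FiniteDist x y → x ≠ y →
            ‖elt (T.abelAverage ε ρ) x y‖
              ≤ C * gdist x y ^ (3 * (n - 1)) * Real.exp (-μ * gdist x y / 3)
                + ε * C * ∑ u ∈ third x y, ∑ v ∈ third y x,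
                    Real.exp (-μ * gdist x u) * Real.exp (-μ * gdist y v) * ‖elt ρ u v‖) ∧
        -- the decay of steady states
        (∀ ρ : Op Λ, IsState ρ → T.lindbladian ρ = 0 →
          ∀ x y : Λ, FiniteDist x y → x ≠ y →
            ‖elt ρ x y‖
              ≤ C * gdist x y ^ (3 * (n - 1)) * Real.exp (-μ * gdist x y / 3))) ∧
    -- any amount of local dephasing among the Lindblad operators produces a uniform gap
    (∀ (Λ : Set (Fin n → ℤ)) (T : LindbladTerms Λ) (c : ℂ), c ≠ 0 →
      (∀ v : Λ, ∃ i, T.jump {v} i = c • InnerProductSpace.rankOne ℂ (δ v) (δ v)) →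
      T.HasUniformGap (‖c‖ ^ 2 / 2)) := by
  refine ⟨?_, fun Λ T c _ h => LindbladTerms.hasUniformGap_of_dephasing T c h⟩
  obtain ⟨m, hm⟩ := exists_card_ball_le n R
  have hκ : 0 ≤ 2 ^ m * LindbladTerms.driftBound I N := mul_nonneg (by positivity) (LindbladTerms.driftBound_nonneg I N)
  obtain ⟨μ, hμ, hμγ⟩ := exists_pos_exp_rate hγ (mul_nonneg hκ (Nat.cast_nonneg m)) R
  obtain ⟨S, hS0, hS⟩ := exists_sum_exp_gdist_le n hμ
  have hγi : 0 < γ⁻¹ := inv_pos.2 hγ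
  have hR := Real.exp_pos (μ * R)
  set q := 2 * γ⁻¹ * (2 ^ m * LindbladTerms.driftBound I N) * Real.exp (μ * R) * S ^ 2 with hq
  have hq0 : 0 ≤ q := by positivity
  have hCγ : γ⁻¹ ≤ γ⁻¹ + Real.exp (μ * R) + q := by linarith
  have hCR : Real.exp (μ * R) ≤ γ⁻¹ + Real.exp (μ * R) + q := by linarith
  have hCS : q ≤ γ⁻¹ + Real.exp (μ * R) + q := by linarith
  -- The three summands serve the kernel and source terms, the short distances and the boundary
  -- terms; all are fixed before `Λ` and `T` are chosen.
  refine ⟨γ⁻¹ + Real.exp (μ * R) + q, μ, by linarith, hμ, fun Λ T hT hgap => ?_⟩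
  obtain ⟨H, J, Φ, hG⟩ := hT.exists_isGenerator (hm Λ)
  refine ⟨fun x y _ ε hε Γ hΓ u v => ?_, fun ρ hρ ε hε => ?_, fun ρ hρ hρ0 x y hxy hne => ?_⟩
  · refine (LindbladTerms.norm_kernel_le hT (hm Λ) hγ hgap (by positivity : 0 ≤ 2 * μ)
      (by rwa [mul_assoc]) hε.le hΓ u v).trans ?_
    have hu := gdist_nonneg x u.1
    have hv := gdist_nonneg y v.1
    gcongr <;> linarith
  · exact ⟨hG.integrableOn_abelIntegrand hε hρ, fun x y hxy hne =>
      LindbladTerms.norm_elt_le_pow_mul_exp hT hG (hm Λ) hγ hgap hμ.le hμγ (hS Λ) hS0.le hCγ hCR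
        hCS hε.le (hG.norm_abelAverage_le hε hρ) (hG.smul_abelAverage_sub_lindbladian hε hρ) hxy
        hne _⟩
  -- A steady state is the case `ε = 0` with zero source, so it needs neither the evolution nor Abel
  -- averages. For `n = 0` truncated subtraction makes the exponent `0`.
  · have h := LindbladTerms.norm_elt_le_pow_mul_exp (ρ := 0) hT hG (hm Λ) hγ hgap hμ.le hμγ (hS Λ)
      hS0.le hCγ hCR hCS le_rfl hρ.isMixture.norm_le (by simp [hρ0]) hxy hne (3 * (n - 1))
    simpa using h
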